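/- There exist absolute constants $C_3>0$ and $C_4>0$ such that the following holds. Let $n\ge 1$ and let $X_1,\dots,X_n$ be identically distributed, $1$-dependent random variables with values in the non-negative integers, i.e. whenever $1\le s<t\le n$ and $t-s>1$, the $\sigma$-algebras generated by $X_1,\dots,X_s$ and by $X_t,\dots,X_n$ are independent; assume also that $\mathbb E X_kX_{k+1}=\mathbb E X_1X_2$ for all $1\le k\le n-1$ (as is the case for a stationary sequence). Put $S_n=X_1+\dots+X_n$, $\nu_1=\mathbb E X_1$ and $\nu_2=\mathbb E X_1(X_1-1)$, and assume $\nu_1>0$. Let $x$ be a positive integer, let $C_0\ge 1$ be a real number, and put $$y=\frac{x-n\nu_1}{n\nu_1},\qquad \gamma=e^{1.5\,C_0}\max(\nu_1^2,\nu_2,\mathbb E X_1X_2),$$ $$\lambda^*=\nu_1\Big(1-\frac{\nu_1}{1-\nu_1}\,y\Big),\qquad \Lambda^*(y)=n\sum_{j=2}^\infty\frac1j\Big(\frac{\nu_1}{1-\nu_1}\Big)^j y^j .$$ Assume that $$X_1\le C_0\ \text{ almost surely},\qquad e^{5C_0}\nu_1\le 0.002,\qquad |y|\le\tfrac1{10},$$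 $$\nu_2\le\frac{\nu_1e^{-1.5\,C_0}}{20},\qquad \mathbb E X_1X_2\le\frac{\nu_1e^{-1.5\,C_0}}{20},\qquad x>n\nu_1 .$$ Let $Z_n^*$ be a Poisson random variable with parameter $n\lambda^*$. Then there is a real number $\theta$ with $|\theta|\le 1$ such that $$\frac{P(S_n\ge x)}{P(Z_n^*\ge x)}=e^{\Lambda^*(y)}\,(1+C_3\gamma y^2)^n\,\Big(1+C_4\,\theta\,\gamma\sqrt{n\nu_1}\,\big(\nu_1^{-1}+ny^2\big)\Big).$$ -/

import Mathlib

open MeasureTheory ProbabilityTheory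
open scoped NNReal

noncomputable section

/-- The finite sequence `X 1, …, X n` is `m`-dependent: whenever `1 ≤ s < t ≤ n` and `t - s > m`,
the σ-algebras generated by `X 1, …, X s` and by `X t, …, X n` are independent. -/
def IsMDependent {Ω : Type*} [MeasurableSpace Ω] (m n : ℕ) (X : ℕ → Ω → ℕ) (μ : Measure Ω) : Prop :=
  ∀ s t : ℕ, 1 ≤ s → t ≤ n → s + m < t →
    Indep (⨆ i ∈ Set.Icc 1 s, MeasurableSpace.comap (X i) inferInstance)
      (⨆ i ∈ Set.Icc t n, MeasurableSpace.comap (X i) inferInstance) μ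

/-- First factorial moment `E Y`. -/
def factMoment1 {Ω : Type*} [MeasurableSpace Ω] (Y : Ω → ℕ) (μ : Measure Ω) : ℝ :=
  ∫ ω, (Y ω : ℝ) ∂μ

/-- Second factorial moment `E Y (Y - 1)`. -/
def factMoment2 {Ω : Type*} [MeasurableSpace Ω] (Y : Ω → ℕ) (μ : Measure Ω) : ℝ :=
  ∫ ω, (Y ω : ℝ) * ((Y ω : ℝ) - 1) ∂μ

/-- Mixed moment `E Y Z`. -/
def mixedMoment {Ω : Type*} [MeasurableSpace Ω] (Y Z : Ω → ℕ) (μ : Measure Ω) : ℝ :=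
  ∫ ω, (Y ω : ℝ) * (Z ω : ℝ) ∂μ

/-- The relative deviation `y = (x - n ν₁) / (n ν₁)`. -/
def relDev (n x : ℕ) (ν₁ : ℝ) : ℝ := ((x : ℝ) - n * ν₁) / (n * ν₁)

/-- `γ = exp (1.5 C₀) max (ν₁², ν₂, E X₁X₂)`, where `κ` stands for `E X₁X₂`. -/
def gammaCoeff (C₀ ν₁ ν₂ κ : ℝ) : ℝ :=
  Real.exp (1.5 * C₀) * max (max (ν₁ ^ 2) ν₂) κ

/-- `λ* = ν₁ (1 - ν₁ y / (1 - ν₁))`. -/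
def lambdaStar (ν₁ y : ℝ) : ℝ := ν₁ * (1 - ν₁ / (1 - ν₁) * y)

/-- `Λ*(y) = n ∑_{j ≥ 2} (1 / j) (ν₁ / (1 - ν₁))^j y^j` (summed with `j` shifted by `2`). -/
def LambdaStar (n : ℕ) (ν₁ y : ℝ) : ℝ :=
  n * ∑' j : ℕ, (1 / ((j + 2 : ℕ) : ℝ)) * (ν₁ / (1 - ν₁)) ^ (j + 2) * y ^ (j + 2)

/-- `P (Z ≥ x)` for a Poisson variable `Z` with parameter `r`. -/
def poissonTail (r : ℝ) (x : ℕ) : ℝ := (poissonMeasure r.toNNReal).real (Set.Ici x)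

end

set_option linter.unusedSectionVars false

/-! Write `N = n ν₁` and `ε = (γ / ν₁) (1 + (x - N)² / N)`. The error allowed in the theorem is a
large constant times `√N ε`, and the factor `√N` (bounded below, since `1 ≤ x ≤ 1.1 N`) is room to
spare. This permits a split according to whether `400 ε ≤ 1`.

If `ε` is small, the Stein-Chen method is run with relative errors. The solution of the Stein
equation for `{x, x + 1, …}` has increments dominated by `1 / N` times a monotone envelope, and the
expectation of that envelope under the Poisson law is at most the tail at `x` times `3 + (x - N)² /
N` (`sum_steinEnvelope_le`). The error involves the expectation of the envelope at a sum with a few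
variables deleted. That expectation is compared with the Poisson one through the largest ratio `M`
of the two tails on `{0, …, x}` (`integral_monotone_le`), so the error is at most `198 ε M` times
the Poisson tail. Applied at the point where `M` is attained, this bounds `M` itself: either that
point is at most `N`, where the Poisson tail is bounded below by `e⁻⁸`, or `M - 1 ≤ M / 2`.
Replacing `N` by `n λ*` and inserting the factors `e^{Λ*}` and `(1 + 5 γ y²)^n` then costs only
`O(ε)`.

If `ε` is not small, the allowed relative error exceeds `1`, the lower bound is trivial, and only an
upper bound for the ratio is needed. A Chernoff bound with tilt `1 + y = x / N`
(`measure_ge_mul_pow_le_exp`), set against a lower bound for the Poisson tail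
(`exp_le_upperTail_shift`), gives `(1 + 5 γ y²)^n` times `O(1 + y √N)`, and the room `√N` absorbs
the last factor. -/

/-- The Poisson weight `e^{-L} L^k / k!`. -/
noncomputable def poissonWeight (L : ℝ) (k : ℕ) : ℝ := Real.exp (-L) * L ^ k / k.factorial

/-- The Poisson upper tail `∑_{i ≥ k} e^{-L} L^i / i!`, written as a finite expression. -/
noncomputable def upperTail (L : ℝ) (k : ℕ) : ℝ := 1 - ∑ i ∈ Finset.range k, poissonWeight L i

/-! ### Poisson weights and upper tails. -/

section Poisson

variable {L : ℝ}

lemma poissonWeight_pos (hL : 0 < L) (k : ℕ) : 0 < poissonWeight L k := by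
  unfold poissonWeight; positivity

lemma poissonWeight_succ (L : ℝ) (k : ℕ) :
    ((k : ℝ) + 1) * poissonWeight L (k + 1) = L * poissonWeight L k := by
  unfold poissonWeight
  rw [Nat.factorial_succ]
  push_cast
  have : (k.factorial : ℝ) ≠ 0 := by positivity
  have : (k : ℝ) + 1 ≠ 0 := by positivity
  field_simp
  ring

@[simp] lemma upperTail_zero (L : ℝ) : upperTail L 0 = 1 := by simp [upperTail]

lemma upperTail_succ (L : ℝ) (k : ℕ) :
    upperTail L (k + 1) = upperTail L k - poissonWeight L k := by
  simp only [upperTail, Finset.sum_range_succ]; ring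

lemma upperTail_eq_sum_add (L : ℝ) (x m : ℕ) :
    upperTail L x = ∑ j ∈ Finset.range m, poissonWeight L (x + j) + upperTail L (x + m) := by
  induction m with
  | zero => simp
  | succ m ih => rw [Finset.sum_range_succ, ← add_assoc, upperTail_succ, ih]; ring

lemma hasSum_poissonWeight (L : ℝ) (hL : 0 ≤ L) : HasSum (poissonWeight L) 1 := by
  have := hasSum_one_poissonMeasure ⟨L, hL⟩
  exact this

lemma upperTail_nonneg (hL : 0 < L) (k : ℕ) : 0 ≤ upperTail L k := by
  have := sum_le_hasSum (Finset.range k) (fun i _ => (poissonWeight_pos hL i).le)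
    (hasSum_poissonWeight L hL.le)
  unfold upperTail; linarith

lemma upperTail_le_one (hL : 0 < L) (k : ℕ) : upperTail L k ≤ 1 := by
  have := Finset.sum_nonneg fun i (_ : i ∈ Finset.range k) => (poissonWeight_pos hL i).le
  unfold upperTail; linarith

lemma poissonWeight_le_upperTail (hL : 0 < L) (k : ℕ) : poissonWeight L k ≤ upperTail L k := by
  have := upperTail_nonneg hL (k + 1)
  rw [upperTail_succ] at this; linarith

lemma upperTail_pos (hL : 0 < L) (k : ℕ) : 0 < upperTail L k :=
  (poissonWeight_pos hL k).trans_le (poissonWeight_le_upperTail hL k)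

lemma upperTail_antitone (hL : 0 < L) : Antitone (upperTail L) :=
  antitone_nat_of_succ_le fun k => by
    rw [upperTail_succ]; linarith [poissonWeight_pos hL k]

lemma poissonTail_eq_upperTail (hL : 0 < L) (x : ℕ) : poissonTail L x = upperTail L x := by
  have h1 : (poissonMeasure L.toNNReal).real (Set.Ici x) =
      1 - (poissonMeasure L.toNNReal).real (Finset.range x : Set ℕ) := by
    rw [← probReal_compl_eq_one_sub (by measurability)]
    congr 1
    ext i; simp
  unfold poissonTail upperTail
  rw [h1, ← sum_measureReal_singleton]
  congr 1
  refine Finset.sum_congr rfl fun i _ => ?_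
  rw [poissonMeasure_real_singleton, Real.coe_toNNReal _ hL.le, poissonWeight]

lemma tendsto_upperTail (hL : 0 < L) :
    Filter.Tendsto (upperTail L) Filter.atTop (nhds 0) := by
  have := ((hasSum_poissonWeight L hL.le).tendsto_sum_nat).const_sub 1
  rwa [sub_self] at this

/-- The ratio of consecutive weights beyond `x` is at most `L / x`, so the tail is dominated by a
geometric series. -/
lemma poissonWeight_add_le (hL : 0 < L) {x : ℕ} (hx : 0 < x) (j : ℕ) :
    poissonWeight L (x + j) ≤ poissonWeight L x * (L / x) ^ j := by
  induction j with
  | zero => simp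
  | succ j ih =>
    have hx' : (0 : ℝ) < x := by exact_mod_cast hx
    have h := poissonWeight_succ L (x + j)
    push_cast at h
    have hp := poissonWeight_pos hL (x + (j + 1))
    rw [← add_assoc] at hp ⊢
    rw [pow_succ, ← mul_assoc]
    have h2 : poissonWeight L (x + j + 1) * x ≤ L * poissonWeight L (x + j) := by
      rw [← h]; nlinarith [hp, (Nat.cast_nonneg j : (0 : ℝ) ≤ j)]
    calc poissonWeight L (x + j + 1) ≤ L * poissonWeight L (x + j) / x := by
          rw [le_div_iff₀ hx']; exact h2
      _ ≤ L * (poissonWeight L x * (L / x) ^ j) / x := by gcongr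
      _ = _ := by ring

/-- The Mills-type upper bound for a Poisson tail. -/
lemma sub_mul_upperTail_le (hL : 0 < L) (x : ℕ) :
    ((x : ℝ) - L) * upperTail L x ≤ x * poissonWeight L x := by
  rcases le_or_gt (x : ℝ) L with h | h
  · have := upperTail_nonneg hL x
    have := poissonWeight_pos hL x
    have : ((x : ℝ) - L) * upperTail L x ≤ 0 := mul_nonpos_of_nonpos_of_nonneg (by linarith) ‹_›
    have : 0 ≤ (x : ℝ) * poissonWeight L x := by positivity
    linarith
  have hx : (0 : ℝ) < x := hL.trans h
  have hx' : 0 < x := by exact_mod_cast hx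
  have hr0 : 0 ≤ L / x := by positivity
  have hr1 : L / x < 1 := (div_lt_one hx).2 h
  have hlim : Filter.Tendsto (fun m => poissonWeight L x * (1 - L / x)⁻¹ + upperTail L (m + x))
      Filter.atTop (nhds (poissonWeight L x * (1 - L / x)⁻¹ + 0)) :=
    tendsto_const_nhds.add ((Filter.tendsto_add_atTop_iff_nat x).2 (tendsto_upperTail hL))
  have key : upperTail L x ≤ poissonWeight L x * (1 - L / x)⁻¹ + 0 := by
    refine ge_of_tendsto' hlim fun m => ?_
    rw [upperTail_eq_sum_add L x m, add_comm m x]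
    gcongr
    calc _ ≤ ∑ j ∈ Finset.range m, poissonWeight L x * (L / x) ^ j :=
          Finset.sum_le_sum fun j _ => poissonWeight_add_le hL hx' j
      _ = poissonWeight L x * ∑ j ∈ Finset.range m, (L / x) ^ j := by rw [Finset.mul_sum]
      _ ≤ _ := by
          gcongr
          · exact (poissonWeight_pos hL x).le
          · rw [← tsum_geometric_of_lt_one hr0 hr1]
            exact (summable_geometric_of_lt_one hr0 hr1).sum_le_tsum _ (fun i _ => by positivity)
  calc ((x : ℝ) - L) * upperTail L x ≤ (x - L) * (poissonWeight L x * (1 - L / x)⁻¹ + 0) :=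
        mul_le_mul_of_nonneg_left key (by linarith)
    _ = _ := by
        have : (x : ℝ) - L ≠ 0 := by linarith
        have h3 : 1 - L / x = (x - L) / x := by field_simp
        rw [h3]; field_simp; ring

lemma poissonWeight_mul_pow_le (hL : 0 < L) (x j : ℕ) :
    poissonWeight L x * (L / (x + j)) ^ j ≤ poissonWeight L (x + j) := by
  rcases Nat.eq_zero_or_pos j with rfl | hj
  · simp
  have hpos : (0 : ℝ) < x + j := by positivity
  have key : ∀ i ≤ j, poissonWeight L x * (L / (x + j)) ^ i ≤ poissonWeight L (x + i) := by
    intro i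
    induction i with
    | zero => simp
    | succ i ih =>
      intro hi
      have ih := ih (by omega)
      have h := poissonWeight_succ L (x + i)
      push_cast at h
      have hp := poissonWeight_pos hL (x + i + 1)
      have hij : (i : ℝ) + 1 ≤ j := by exact_mod_cast hi
      have h2 : L * poissonWeight L (x + i) ≤ poissonWeight L (x + i + 1) * (x + j) := by
        rw [← h]; nlinarith
      rw [← add_assoc, pow_succ, ← mul_assoc]
      calc _ ≤ poissonWeight L (x + i) * (L / (x + j)) := by gcongr
        _ = L * poissonWeight L (x + i) / (x + j) := by ring
        _ ≤ _ := by rw [div_le_iff₀ hpos]; exact h2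
  exact key j le_rfl

/-- A lower bound for a Poisson tail in terms of its first weight. -/
lemma poissonWeight_mul_sqrt_le (hL : 0 < L) {x : ℕ} (hx : L ≤ x) :
    poissonWeight L x * √L ≤ Real.exp 2 * (1 + (x - L) / √L) * upperTail L x := by
  set t := (x - L) / √L with ht
  have hs : 0 < √L := Real.sqrt_pos.2 hL
  have hss : √L * √L = L := Real.mul_self_sqrt hL.le
  have ht0 : 0 ≤ t := by rw [ht]; exact div_nonneg (by linarith) hs.le
  have hxt : (x : ℝ) - L = t * √L := by rw [ht]; field_simp
  -- The weights stay within a factor `e⁻²` of the first one over this many terms: for `j ≤ √L / (1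
  -- + t)` the exponent `j (x + j - L) / L` is at most `t / (1 + t) + 1 / (1 + t)² ≤ 2`.
  set m := ⌊√L / (1 + t)⌋₊ + 1 with hm
  have hterm : ∀ j ∈ Finset.range m,
      Real.exp (-2) * poissonWeight L x ≤ poissonWeight L (x + j) := by
    intro j hj
    have hj' : (j : ℝ) ≤ √L / (1 + t) := by
      have : j ≤ ⌊√L / (1 + t)⌋₊ := by have := Finset.mem_range.1 hj; omega
      exact (Nat.le_floor_iff (by positivity)).1 this
    have hj2 : (j : ℝ) * (1 + t) ≤ √L := (le_div_iff₀ (by positivity)).1 hj'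
    have hj0 : (0 : ℝ) ≤ j := Nat.cast_nonneg j
    have hposx : (0 : ℝ) < x + j := by linarith
    refine le_trans ?_ (poissonWeight_mul_pow_le hL x j)
    rw [mul_comm]
    have hp := (poissonWeight_pos hL x).le
    gcongr
    have h1 : Real.exp (-((x + j - L) / L)) ≤ L / (x + j) := by
      have h2 := Real.add_one_le_exp ((x + j - L) / L)
      have h3 : (x + j : ℝ) / L ≤ Real.exp ((x + j - L) / L) := by
        refine le_trans (le_of_eq ?_) h2
        field_simp; ring
      rw [Real.exp_neg, ← inv_div (x + j : ℝ) L]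
      exact inv_anti₀ (by positivity) h3
    calc Real.exp (-2) ≤ Real.exp (-((x + j - L) / L)) ^ j := by
          rw [← Real.exp_nat_mul, Real.exp_le_exp]
          have h4 : (j : ℝ) * ((x + j - L) / L) ≤ 2 := by
            have : (x : ℝ) + j - L = t * √L + j := by linarith
            rw [this, ← mul_div_assoc, div_le_iff₀ hL]
            nlinarith [mul_nonneg hj0 ht0, mul_nonneg (mul_nonneg hj0 ht0) hs.le]
          linarith
      _ ≤ _ := by gcongr
  have hsum : (m : ℝ) * (Real.exp (-2) * poissonWeight L x) ≤ upperTail L x := by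
    rw [upperTail_eq_sum_add L x m]
    have := Finset.sum_le_sum hterm
    rw [Finset.sum_const, Finset.card_range, nsmul_eq_mul] at this
    linarith [upperTail_nonneg hL (x + m)]
  have hmge : √L ≤ m * (1 + t) := by
    have := Nat.lt_floor_add_one (√L / (1 + t))
    rw [div_lt_iff₀ (by positivity)] at this
    rw [hm]; push_cast; exact this.le
  have he : Real.exp 2 * Real.exp (-2) = 1 := by rw [← Real.exp_add]; simp
  calc poissonWeight L x * √L ≤ poissonWeight L x * (m * (1 + t)) := by
        gcongr; exact (poissonWeight_pos hL x).le
    _ = Real.exp 2 * (1 + t) * (m * (Real.exp (-2) * poissonWeight L x)) := by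
        linear_combination (-(poissonWeight L x * (m * (1 + t)))) * he
    _ ≤ _ := by gcongr

/-- The Stirling sequence decreases from its value `e / √2` at `1`. -/
lemma factorial_le_stirling {x : ℕ} (hx : 0 < x) :
    (x.factorial : ℝ) ≤ Real.exp 1 * √x * (x / Real.exp 1) ^ x := by
  obtain ⟨m, rfl⟩ : ∃ m, x = m + 1 := ⟨x - 1, by omega⟩
  have h := Stirling.stirlingSeq'_antitone (Nat.zero_le m)
  simp only [Function.comp, Nat.succ_eq_add_one, zero_add, Stirling.stirlingSeq_one] at h
  rw [Stirling.stirlingSeq, div_le_iff₀ (by positivity), Real.sqrt_mul (by norm_num)] at h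
  refine h.trans (le_of_eq ?_)
  have : √2 ≠ 0 := by positivity
  field_simp

/-- Chernoff-type lower bound for a Poisson tail. -/
lemma chernoff_le_upperTail (hL : 0 < L) {x : ℕ} (hx : L ≤ x) (hx3 : x ≤ 3 * L) :
    (L / x) ^ x * Real.exp (x - L) ≤
      Real.exp 4 * (1 + (x - L) / √L) * upperTail L x := by
  have hx0 : (0 : ℝ) < x := hL.trans_le hx
  have hx0' : 0 < x := by exact_mod_cast hx0
  have hs : 0 < √L := Real.sqrt_pos.2 hL
  have hw : (L / x) ^ x * Real.exp (x - L) ≤ Real.exp 1 * √x * poissonWeight L x := by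
    have h := factorial_le_stirling hx0'
    unfold poissonWeight
    have hf : (0 : ℝ) < x.factorial := by positivity
    rw [← mul_div_assoc, le_div_iff₀ hf]
    calc _ ≤ (L / x) ^ x * Real.exp (x - L) * (Real.exp 1 * √x * (x / Real.exp 1) ^ x) := by gcongr
      _ = _ := by
        have : Real.exp ((x : ℝ) - L) = Real.exp 1 ^ x * Real.exp (-L) := by
          rw [← Real.exp_nat_mul, ← Real.exp_add]; congr 1; ring
        rw [this, div_pow, div_pow]
        field_simp
  have h3 : √x ≤ Real.exp 1 * √L := by
    rw [Real.sqrt_le_left (by positivity), mul_pow, Real.sq_sqrt hL.le]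
    have : 2 ≤ Real.exp 1 := by linarith [Real.exp_one_gt_d9]
    have : 4 ≤ Real.exp 1 ^ 2 := by nlinarith
    nlinarith
  calc _ ≤ Real.exp 1 * √x * poissonWeight L x := hw
    _ ≤ Real.exp 1 * (Real.exp 1 * √L) * poissonWeight L x := by
        gcongr; exact (poissonWeight_pos hL x).le
    _ = Real.exp 2 * (poissonWeight L x * √L) := by
        have : Real.exp 2 = Real.exp 1 * Real.exp 1 := by rw [← Real.exp_add]; norm_num
        rw [this]; ring
    _ ≤ Real.exp 2 * (Real.exp 2 * (1 + (x - L) / √L) * upperTail L x) := by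
        exact mul_le_mul_of_nonneg_left (poissonWeight_mul_sqrt_le hL hx) (Real.exp_pos 2).le
    _ = _ := by
        have : Real.exp 4 = Real.exp 2 * Real.exp 2 := by rw [← Real.exp_add]; norm_num
        rw [this]; ring

/-- A Poisson variable exceeds any point below its mean with probability bounded below. -/
lemma exp_neg_le_upperTail (hL : 10 / 11 ≤ L) {j : ℕ} (hj : j ≤ L) :
    Real.exp (-8) ≤ upperTail L j := by
  have hL0 : 0 < L := by linarith
  have hs : 0 < √L := Real.sqrt_pos.2 hL0
  -- The tail at `j` is at least the tail at the first integer above `L`, which lies within a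
  -- bounded number of standard deviations of the mean because `L` is bounded below.
  set x := ⌊L⌋₊ + 1 with hx
  have h1 : L ≤ x := by rw [hx]; push_cast; exact (Nat.lt_floor_add_one L).le
  have h2 : (x : ℝ) ≤ L + 1 := by
    rw [hx]; push_cast; linarith [Nat.floor_le hL0.le]
  have hx0 : (0 : ℝ) < x := by linarith
  have hjx : j ≤ x := (Nat.le_floor hj).trans (Nat.le_succ _)
  refine le_trans ?_ (upperTail_antitone hL0 hjx)
  have hch := chernoff_le_upperTail hL0 h1 (by linarith)
  have hsl : 9 / 10 ≤ √L := by
    apply Real.le_sqrt_of_sq_le; linarith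
  have h3 : 1 + (x - L) / √L ≤ 3 := by
    have : (x - L) / √L ≤ 2 := by rw [div_le_iff₀ hs]; linarith
    linarith
  have h4 : Real.exp (-2) ≤ (L / x) ^ x * Real.exp (x - L) := by
    have h5 : Real.exp (-((x - L) / L)) ≤ L / x := by
      have h6 := Real.add_one_le_exp ((x - L) / L)
      have h7 : (x : ℝ) / L ≤ Real.exp ((x - L) / L) :=
        le_trans (le_of_eq (by field_simp; ring)) h6
      rw [Real.exp_neg, ← inv_div (x : ℝ) L]
      exact inv_anti₀ (by positivity) h7
    calc Real.exp (-2) ≤ Real.exp (-((x - L) / L)) ^ x * Real.exp (x - L) := by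
          rw [← Real.exp_nat_mul, ← Real.exp_add, Real.exp_le_exp]
          have : (x : ℝ) * -((x - L) / L) + (x - L) = -((x - L) ^ 2 / L) := by field_simp; ring
          rw [this, neg_le_neg_iff, div_le_iff₀ hL0]
          nlinarith
      _ ≤ _ := by gcongr
  have h8 : Real.exp (-2) ≤ Real.exp 4 * 3 * upperTail L x := by
    refine (h4.trans hch).trans ?_
    gcongr
    exact upperTail_nonneg hL0 x
  have h9 : (3 : ℝ) ≤ Real.exp 2 := by linarith [Real.add_one_le_exp (2 : ℝ)]
  have h10 : Real.exp (-2) ≤ Real.exp 6 * upperTail L x := by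
    refine h8.trans ?_
    have : Real.exp 6 = Real.exp 4 * Real.exp 2 := by rw [← Real.exp_add]; norm_num
    rw [this]
    gcongr
    exact upperTail_nonneg hL0 x
  have h11 : Real.exp (-8) = Real.exp (-6) * Real.exp (-2) := by rw [← Real.exp_add]; norm_num
  have h12 : Real.exp (-6) * Real.exp 6 = 1 := by rw [← Real.exp_add]; simp
  rw [h11]
  calc _ ≤ Real.exp (-6) * (Real.exp 6 * upperTail L x) := by gcongr
    _ = _ := by rw [← mul_assoc, h12, one_mul]

lemma hasDerivAt_poissonWeight_zero (L : ℝ) :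
    HasDerivAt (fun s => poissonWeight s 0) (-poissonWeight L 0) L := by
  have h : (fun s => poissonWeight s 0) = fun s => Real.exp (-s) :=
    funext fun s => by simp [poissonWeight]
  rw [h]
  exact ((hasDerivAt_neg L).exp).congr_deriv (by simp [poissonWeight])

lemma hasDerivAt_poissonWeight_succ (L : ℝ) (k : ℕ) :
    HasDerivAt (fun s => poissonWeight s (k + 1)) (poissonWeight L k - poissonWeight L (k + 1)) L := by
  have h := (((hasDerivAt_neg L).exp).mul (hasDerivAt_pow (k + 1) L)).div_const
    ((k + 1).factorial : ℝ)
  refine h.congr_deriv ?_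
  unfold poissonWeight
  rw [Nat.factorial_succ]
  push_cast
  have : (k.factorial : ℝ) ≠ 0 := by positivity
  have : (k : ℝ) + 1 ≠ 0 := by positivity
  field_simp
  ring

/-- The derivatives of the weights in the parameter telescope, leaving a single weight. -/
lemma hasDerivAt_upperTail (L : ℝ) (k : ℕ) :
    HasDerivAt (fun s => upperTail s (k + 1)) (poissonWeight L k) L := by
  induction k with
  | zero =>
    have h : (fun s => upperTail s (0 + 1)) = fun s => 1 - poissonWeight s 0 :=
      funext fun s => by rw [upperTail_succ, upperTail_zero]
    rw [h]
    exact ((hasDerivAt_poissonWeight_zero L).const_sub 1).congr_deriv (neg_neg _)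
  | succ k ih =>
    have := ih.sub (hasDerivAt_poissonWeight_succ L k)
    have h : (fun s => upperTail s (k + 1 + 1)) =
        fun s => upperTail s (k + 1) - poissonWeight s (k + 1) :=
      funext fun s => upperTail_succ s (k + 1)
    rw [h]
    refine this.congr_deriv (by ring)

/-- The function `s ↦ e^{-s} s^x` increases up to `s = x`. -/
lemma poissonWeight_mono {s : ℝ} (hs : 0 < s) (hsL : s ≤ L) {x : ℕ} (hx : L ≤ x) :
    poissonWeight s x ≤ poissonWeight L x := by
  have hL : 0 < L := hs.trans_le hsL
  unfold poissonWeight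
  gcongr ?_ / _
  have h1 : s / L ≤ Real.exp (-((L - s) / L)) := by
    have := Real.add_one_le_exp (-((L - s) / L))
    refine le_trans (le_of_eq ?_) this
    field_simp; ring
  have h2 : (s / L) ^ x ≤ Real.exp (-(L - s)) := by
    calc _ ≤ Real.exp (-((L - s) / L)) ^ x := by gcongr
      _ = Real.exp (x * -((L - s) / L)) := by rw [← Real.exp_nat_mul]
      _ ≤ _ := by
        rw [Real.exp_le_exp]
        have : L - s ≤ x * ((L - s) / L) := by
          rw [← mul_div_assoc, le_div_iff₀ hL]
          nlinarith
        linarith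
  rw [div_pow, div_le_iff₀ (by positivity)] at h2
  calc Real.exp (-s) * s ^ x ≤ Real.exp (-s) * (Real.exp (-(L - s)) * L ^ x) := by gcongr
    _ = _ := by rw [← mul_assoc, ← Real.exp_add]; congr 2; ring

/-- Dependence of a Poisson tail on the parameter. -/
lemma upperTail_sub_le {s : ℝ} (hs : 0 < s) (hsL : s ≤ L) {x : ℕ} (hx : L ≤ x) :
    upperTail L x - upperTail s x ≤ (x / s * poissonWeight L x) * (L - s) := by
  have hL : 0 < L := hs.trans_le hsL
  have hx0 : 0 < x := by exact_mod_cast hL.trans_le hx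
  obtain ⟨k, rfl⟩ : ∃ k, x = k + 1 := ⟨x - 1, by omega⟩
  have hD : ∀ u, HasDerivAt (fun s => upperTail s (k + 1)) (poissonWeight u k) u :=
    fun u => hasDerivAt_upperTail u k
  refine Convex.image_sub_le_mul_sub_of_deriv_le (convex_Icc s L)
    (f := fun s => upperTail s (k + 1)) (fun u _ => (hD u).continuousAt.continuousWithinAt)
    (fun u _ => (hD u).differentiableAt.differentiableWithinAt) ?_ s ⟨le_rfl, hsL⟩ L ⟨hsL, le_rfl⟩
    hsL
  intro u hu
  rw [interior_Icc] at hu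
  rw [(hD u).deriv]
  have hu0 : 0 < u := hs.trans hu.1
  have h1 := poissonWeight_succ u k
  have h2 := poissonWeight_mono hu0 hu.2.le hx
  have : poissonWeight u k = ((k : ℝ) + 1) / u * poissonWeight u (k + 1) := by
    field_simp; linarith
  rw [this]
  push_cast
  have h3 := (poissonWeight_pos hu0 (k+1)).le
  have h4 := hu.1.le
  gcongr

lemma upperTail_mono {s : ℝ} (hs : 0 < s) (hsL : s ≤ L) (x : ℕ) :
    upperTail s x ≤ upperTail L x := by
  rcases x with _ | k
  · simp
  have hD : ∀ u, HasDerivAt (fun s => upperTail s (k + 1)) (poissonWeight u k) u :=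
    fun u => hasDerivAt_upperTail u k
  refine monotoneOn_of_deriv_nonneg (convex_Icc s L)
    (f := fun s => upperTail s (k + 1)) (fun u _ => (hD u).continuousAt.continuousWithinAt)
    (fun u _ => (hD u).differentiableAt.differentiableWithinAt) ?_ ⟨le_rfl, hsL⟩ ⟨hsL, le_rfl⟩ hsL
  intro u hu
  rw [interior_Icc] at hu
  rw [(hD u).deriv]
  exact (poissonWeight_pos (hs.trans hu.1) k).le

end Poisson

/-! ### The Stein-Chen equation for a half-line. -/

/-- The sequence `k ↦ P (Z < k) / P (Z = k - 1)` for a Poisson variable `Z` with parameter `L`,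
given by its recursion (with the convenient value `1` at `0`). -/
noncomputable def steinSeq (L : ℝ) : ℕ → ℝ
  | 0 => 1
  | k + 1 => 1 + k / L * steinSeq L k

/-- The increments of `steinSeq`. -/
noncomputable def steinIncr (L : ℝ) (k : ℕ) : ℝ := steinSeq L (k + 1) - steinSeq L k

/-- The (negated) solution of the Stein-Chen equation for the set `{x, x + 1, …}`. -/
noncomputable def steinSol (L : ℝ) (x k : ℕ) : ℝ :=
  if k ≤ x then upperTail L x * steinSeq L k / L
  else (1 - upperTail L x) * upperTail L k / (k * poissonWeight L k)

/-- A monotone majorant for `L` times the increments of `steinSol L x`. -/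
noncomputable def steinEnvelope (L : ℝ) (x k : ℕ) : ℝ :=
  if k < x then upperTail L x * steinIncr L k else 2

section Stein

variable {L : ℝ}

lemma steinSeq_succ (L : ℝ) (k : ℕ) : steinSeq L (k + 1) = 1 + k / L * steinSeq L k := rfl

lemma steinSeq_succ_mul_poissonWeight (hL : 0 < L) (k : ℕ) :
    steinSeq L (k + 1) * poissonWeight L k = 1 - upperTail L (k + 1) := by
  induction k with
  | zero => simp [steinSeq, upperTail_succ]
  | succ k ih =>
    have h := poissonWeight_succ L k
    rw [steinSeq_succ, upperTail_succ]
    have h2 : ((k + 1 : ℕ) : ℝ) / L * steinSeq L (k + 1) * poissonWeight L (k + 1) =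
        steinSeq L (k + 1) * poissonWeight L k := by
      push_cast
      field_simp
      linear_combination steinSeq L (k + 1) * h
    rw [add_mul, h2, ih]; ring

lemma steinSeq_eq (hL : 0 < L) {k : ℕ} (hk : 0 < k) :
    steinSeq L k = L * (1 - upperTail L k) / (k * poissonWeight L k) := by
  obtain ⟨m, rfl⟩ : ∃ m, k = m + 1 := ⟨k - 1, by omega⟩
  have h := poissonWeight_succ L m
  have h1 := steinSeq_succ_mul_poissonWeight hL m
  have h2 := poissonWeight_pos hL m
  push_cast
  rw [h, ← h1]
  field_simp

lemma steinSeq_pos (hL : 0 < L) (k : ℕ) : 0 < steinSeq L k := by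
  induction k with
  | zero => simp [steinSeq]
  | succ k ih => rw [steinSeq_succ]; positivity

lemma steinIncr_zero (L : ℝ) : steinIncr L 0 = 0 := by simp [steinIncr, steinSeq]

lemma steinIncr_succ (L : ℝ) (k : ℕ) :
    steinIncr L (k + 1) = (steinSeq L (k + 1) + k * steinIncr L k) / L := by
  unfold steinIncr
  rw [steinSeq_succ L (k + 1), steinSeq_succ L k]
  push_cast
  ring

lemma steinIncr_nonneg (hL : 0 < L) (k : ℕ) : 0 ≤ steinIncr L k := by
  induction k with
  | zero => simp [steinIncr_zero]
  | succ k ih =>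
    rw [steinIncr_succ]
    have := steinSeq_pos hL (k + 1)
    positivity

/-- The recursion `steinIncr_succ` has nonnegative terms, each growing with the index, so
monotonicity propagates by induction. -/
lemma steinIncr_monotone (hL : 0 < L) : Monotone (steinIncr L) := by
  refine monotone_nat_of_le_succ fun k => ?_
  induction k with
  | zero => rw [steinIncr_zero]; exact steinIncr_nonneg hL 1
  | succ k ih =>
    rw [steinIncr_succ L (k + 1)]
    nth_rewrite 1 [steinIncr_succ L k]
    have h0 := steinIncr_nonneg hL (k + 1)
    have h1 : steinSeq L (k + 1 + 1) = steinSeq L (k + 1) + steinIncr L (k + 1) := by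
      unfold steinIncr; ring
    rw [h1]
    push_cast
    refine div_le_div_of_nonneg_right ?_ hL.le
    nlinarith [mul_le_mul_of_nonneg_left ih (Nat.cast_nonneg k : (0 : ℝ) ≤ k)]

lemma steinIncr_eq (L : ℝ) (k : ℕ) : steinIncr L k = 1 + (k / L - 1) * steinSeq L k := by
  unfold steinIncr; rw [steinSeq_succ]; ring

/-- Exactly, the left side is the weight plus `(k - L) / k` times `P (Z < k)`. Only the overshoot of
`k` above `L` costs more than the weight, and these overshoots sum to `(x - L)² / L`. -/
lemma steinIncr_mul_poissonWeight_le (hL : 0 < L) (k : ℕ) :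
    steinIncr L k * poissonWeight L k ≤ poissonWeight L k + max (k - L) 0 / L := by
  have hp := poissonWeight_pos hL k
  rcases Nat.eq_zero_or_pos k with rfl | hk
  · rw [steinIncr_zero]
    have : 0 ≤ max (((0 : ℕ) : ℝ) - L) 0 / L := by positivity
    linarith
  have hk' : (0 : ℝ) < k := by exact_mod_cast hk
  have hF0 : 0 ≤ 1 - upperTail L k := by linarith [upperTail_le_one hL k]
  have hF1 : 1 - upperTail L k ≤ 1 := by linarith [upperTail_nonneg hL k]
  have heq : steinIncr L k * poissonWeight L k =
      poissonWeight L k + (k - L) / k * (1 - upperTail L k) := by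
    rw [steinIncr_eq, steinSeq_eq hL hk]; field_simp
  rw [heq]
  gcongr
  rcases le_total (k : ℝ) L with h | h
  · rw [max_eq_right (by linarith)]
    have : (k - L) / k ≤ 0 := div_nonpos_of_nonpos_of_nonneg (by linarith) hk'.le
    rw [zero_div]
    exact mul_nonpos_of_nonpos_of_nonneg this hF0
  · rw [max_eq_left (by linarith)]
    have h1 : 0 ≤ (k - L) / k := div_nonneg (by linarith) hk'.le
    calc _ ≤ (k - L) / k * 1 := by gcongr
      _ ≤ _ := by rw [mul_one]; gcongr

/-- The Mills bound cancels the large factor `1 / poissonWeight L x` against the tail. This makes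
the envelope monotone across `x`, where it jumps to `2`. -/
lemma upperTail_mul_steinIncr_le (hL : 0 < L) {x : ℕ} (hx : L < x) :
    upperTail L x * steinIncr L x ≤ 2 := by
  have hx0 : (0 : ℝ) < x := hL.trans hx
  have hx0' : 0 < x := by exact_mod_cast hx0
  have hp := poissonWeight_pos hL x
  have hT0 := upperTail_nonneg hL x
  have hT1 := upperTail_le_one hL x
  have hM := sub_mul_upperTail_le hL x
  have heq : upperTail L x * steinIncr L x =
      upperTail L x + (1 - upperTail L x) * (((x - L) * upperTail L x) / (x * poissonWeight L x)) := by
    rw [steinIncr_eq, steinSeq_eq hL hx0']; field_simp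
  have h1 : ((x - L) * upperTail L x) / (x * poissonWeight L x) ≤ 1 :=
    (div_le_one (by positivity)).2 hM
  have h2 : (1 - upperTail L x) * (((x - L) * upperTail L x) / (x * poissonWeight L x)) ≤
      (1 - upperTail L x) * 1 := by gcongr
  rw [heq]; linarith

lemma steinSol_of_le {x k : ℕ} (h : k ≤ x) :
    steinSol L x k = upperTail L x * steinSeq L k / L := by simp [steinSol, h]

/-- The two branches of the definition agree at `k = x`, so the second formula is valid there too.
-/
lemma steinSol_of_ge (hL : 0 < L) {x k : ℕ} (hx : 0 < x) (h : x ≤ k) :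
    steinSol L x k = (1 - upperTail L x) * upperTail L k / (k * poissonWeight L k) := by
  rcases h.eq_or_lt with rfl | h
  · rw [steinSol_of_le le_rfl, steinSeq_eq hL hx]
    field_simp
  · simp [steinSol, not_le.2 h]

lemma steinSol_equation (hL : 0 < L) {x : ℕ} (hx : 0 < x) (k : ℕ) :
    k * steinSol L x k - L * steinSol L x (k + 1) = (if x ≤ k then 1 else 0) - upperTail L x := by
  rcases lt_or_ge k x with h | h
  · rw [steinSol_of_le h.le, steinSol_of_le h, if_neg (by omega), steinSeq_succ]
    field_simp; ring
  · have hk : (0 : ℝ) < k := by exact_mod_cast hx.trans_le h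
    have hw := poissonWeight_succ L k
    have hp := poissonWeight_pos hL k
    rw [steinSol_of_ge hL hx h, steinSol_of_ge hL hx (h.trans (Nat.le_succ k)), if_pos h]
    push_cast
    rw [hw, upperTail_succ]
    field_simp; ring

lemma steinEnvelope_monotone (hL : 0 < L) {x : ℕ} (hx : L < x) :
    Monotone (steinEnvelope L x) := by
  intro i j hij
  have hT0 := upperTail_nonneg hL x
  unfold steinEnvelope
  split_ifs with h1 h2 h2
  · exact mul_le_mul_of_nonneg_left (steinIncr_monotone hL hij) hT0
  · refine le_trans ?_ (upperTail_mul_steinIncr_le hL hx)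
    exact mul_le_mul_of_nonneg_left (steinIncr_monotone hL h1.le) hT0
  · omega
  · exact le_rfl

lemma steinEnvelope_nonneg (hL : 0 < L) (x k : ℕ) : 0 ≤ steinEnvelope L x k := by
  unfold steinEnvelope
  have hT0 := upperTail_nonneg hL x
  have := steinIncr_nonneg hL k
  split_ifs
  · positivity
  · norm_num

/-- Below `x` the increments are nonnegative and equal the bound. From `x` on they are nonpositive,
and the Mills bound keeps `L` times them in `[-1, 0]`. -/
lemma abs_steinSol_succ_sub_le (hL : 0 < L) {x : ℕ} (hx : L < x) (k : ℕ) :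
    |steinSol L x (k + 1) - steinSol L x k| ≤ steinEnvelope L x k / L := by
  have hx0 : (0 : ℝ) < x := hL.trans hx
  have hx0' : 0 < x := by exact_mod_cast hx0
  rcases lt_or_ge k x with h | h
  · rw [steinSol_of_le h.le, steinSol_of_le h, steinEnvelope, if_pos h, ← sub_div, ← mul_sub]
    refine le_of_eq (abs_of_nonneg ?_)
    have := upperTail_nonneg hL x
    have := steinIncr_nonneg hL k
    unfold steinIncr at this
    positivity
  · have hkx : (x : ℝ) ≤ k := by exact_mod_cast h
    have hk : (0 : ℝ) < k := by linarith
    have hw := poissonWeight_succ L k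
    have hp := poissonWeight_pos hL k
    have hM := sub_mul_upperTail_le hL k
    have hT := upperTail_nonneg hL k
    have hF0 : 0 ≤ 1 - upperTail L x := by linarith [upperTail_le_one hL x]
    have hF1 : 1 - upperTail L x ≤ 1 := by linarith [upperTail_nonneg hL x]
    set u := ((k - L) * upperTail L k) / (k * poissonWeight L k) with hu
    have hu0 : 0 ≤ u := by
      rw [hu]; apply div_nonneg <;> [apply mul_nonneg; positivity] <;> linarith
    have hu1 : u ≤ 1 := (div_le_one (by positivity)).2 hM
    have heq : steinSol L x (k + 1) - steinSol L x k = -((1 - upperTail L x) * (1 - u) / L) := by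
      rw [steinSol_of_ge hL hx0' h, steinSol_of_ge hL hx0' (h.trans (Nat.le_succ k)), hu]
      push_cast
      rw [hw, upperTail_succ]
      field_simp; ring
    rw [heq, abs_neg, abs_of_nonneg (by apply div_nonneg (mul_nonneg hF0 (by linarith)) hL.le),
      steinEnvelope, if_neg (by omega)]
    gcongr
    nlinarith

lemma abs_steinSol_sub_le (hL : 0 < L) {x : ℕ} (hx : L < x) {a b c : ℕ} (hab : a ≤ b)
    (hbc : b ≤ c + 1) :
    |steinSol L x b - steinSol L x a| ≤ (b - a : ℝ) * (steinEnvelope L x c / L) := by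
  induction b, hab using Nat.le_induction with
  | base => simp
  | succ b hab ih =>
    have ih := ih (by omega)
    have h1 := abs_steinSol_succ_sub_le hL hx b
    have h2 : steinEnvelope L x b / L ≤ steinEnvelope L x c / L := by
      gcongr; exact steinEnvelope_monotone hL hx (by omega)
    have h3 := abs_sub_le (steinSol L x (b + 1)) (steinSol L x b) (steinSol L x a)
    push_cast
    linarith

lemma sum_max_sub_le (hL : 0 < L) (x : ℕ) :
    ∑ j ∈ Finset.range x, max ((j : ℝ) - L) 0 / L ≤ max ((x : ℝ) - L) 0 ^ 2 / L := by
  induction x with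
  | zero => simp; positivity
  | succ x ih =>
    rw [Finset.sum_range_succ]
    have : max ((x : ℝ) - L) 0 ^ 2 + max ((x : ℝ) - L) 0 ≤ max (((x + 1 : ℕ) : ℝ) - L) 0 ^ 2 := by
      push_cast
      rcases le_total (x : ℝ) L with h | h
      · rw [max_eq_right (by linarith)]; simp
      · rw [max_eq_left (by linarith), max_eq_left (by linarith)]; nlinarith
    calc _ ≤ max ((x : ℝ) - L) 0 ^ 2 / L + max ((x : ℝ) - L) 0 / L := by gcongr
      _ ≤ _ := by rw [← add_div]; gcongr

/-- The left side is the Poisson expectation of the envelope. The factor `upperTail L x` on the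
right turns the Stein-Chen estimate into a relative one. The constant is `1` from the weights below
`x` plus `2` from the value at `x`. -/
lemma sum_steinEnvelope_le (hL : 0 < L) {x : ℕ} (hx : L < x) :
    ∑ j ∈ Finset.range x, steinEnvelope L x j * poissonWeight L j +
      steinEnvelope L x x * upperTail L x ≤ upperTail L x * (3 + (x - L) ^ 2 / L) := by
  have hT := upperTail_nonneg hL x
  have h1 : ∑ j ∈ Finset.range x, steinEnvelope L x j * poissonWeight L j ≤
      upperTail L x * (1 + (x - L) ^ 2 / L) := by
    calc _ ≤ ∑ j ∈ Finset.range x, upperTail L x * (poissonWeight L j + max (j - L) 0 / L) := by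
          refine Finset.sum_le_sum fun j hj => ?_
          rw [steinEnvelope, if_pos (Finset.mem_range.1 hj), mul_assoc]
          exact mul_le_mul_of_nonneg_left (steinIncr_mul_poissonWeight_le hL j) hT
      _ = upperTail L x * (∑ j ∈ Finset.range x, poissonWeight L j +
          ∑ j ∈ Finset.range x, max (j - L) 0 / L) := by
          rw [← Finset.mul_sum, Finset.sum_add_distrib]
      _ ≤ _ := by
          have h2 : ∑ j ∈ Finset.range x, poissonWeight L j ≤ 1 := by
            have : upperTail L x = 1 - ∑ j ∈ Finset.range x, poissonWeight L j := rfl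
            linarith
          have h3 := sum_max_sub_le hL x
          rw [max_eq_left (by linarith)] at h3
          gcongr
  have h2 : steinEnvelope L x x = 2 := by simp [steinEnvelope]
  rw [h2]; linarith

end Stein

/-! ### Expectations of monotone functions from comparison of tails. -/

section LayerCake

variable {Ω : Type*} [MeasurableSpace Ω] {μ : Measure Ω} [IsProbabilityMeasure μ]

lemma eq_add_sum_increments (β : ℕ → ℝ) (v m : ℕ) :
    β (min v m) = β 0 + ∑ j ∈ Finset.range m, (β (j + 1) - β j) * (if j + 1 ≤ v then 1 else 0) := by
  induction m with
  | zero => simp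
  | succ m ih =>
    rw [Finset.sum_range_succ, ← add_assoc, ← ih]
    split_ifs with h
    · rw [min_eq_right h, min_eq_right (by omega)]; ring
    · rw [min_eq_left (by omega), min_eq_left (by omega)]; ring

/-- Abel summation, a weight being the difference of consecutive tails. It rewrites a bound through
tails as a Poisson expectation. -/
lemma summation_by_parts_upperTail (L : ℝ) (β : ℕ → ℝ) (x : ℕ) :
    β 0 + ∑ j ∈ Finset.range x, (β (j + 1) - β j) * upperTail L (j + 1) =
      ∑ j ∈ Finset.range x, β j * poissonWeight L j + β x * upperTail L x := by
  induction x with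
  | zero => simp
  | succ x ih =>
    rw [Finset.sum_range_succ, Finset.sum_range_succ, ← add_assoc, ih, upperTail_succ]; ring

/-- Comparison of the expectation of a monotone function with a Poisson expectation, given a
comparison of tails. -/
lemma integral_monotone_le {L : ℝ} {β : ℕ → ℝ} (hβ : Monotone β) (hβ0 : 0 ≤ β 0) {x : ℕ}
    (hconst : ∀ k, x ≤ k → β k = β x) {V : Ω → ℕ} (hV : Measurable V) {R : ℝ} (hR : 1 ≤ R)
    (htail : ∀ j ≤ x, μ.real {ω | j ≤ V ω} ≤ R * upperTail L j) :
    ∫ ω, β (V ω) ∂μ ≤ R * (∑ j ∈ Finset.range x, β j * poissonWeight L j + β x * upperTail L x) := by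
  have hms : ∀ j, MeasurableSet {ω | j ≤ V ω} := fun j => hV (measurableSet_Ici (a := j))
  have h1 : ∀ ω, β (V ω) = β 0 + ∑ j ∈ Finset.range x,
      (β (j + 1) - β j) * {ω | j + 1 ≤ V ω}.indicator (fun _ => (1 : ℝ)) ω := by
    intro ω
    have : β (V ω) = β (min (V ω) x) := by
      rcases le_total (V ω) x with h | h
      · rw [min_eq_left h]
      · rw [min_eq_right h, hconst _ h]
    rw [this, eq_add_sum_increments β]
    simp [Set.indicator_apply]
  have hint : ∀ j, Integrable ({ω | j + 1 ≤ V ω}.indicator fun _ => (1 : ℝ)) μ :=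
    fun j => (integrable_const 1).indicator (hms _)
  have h2 : ∫ ω, β (V ω) ∂μ =
      β 0 + ∑ j ∈ Finset.range x, (β (j + 1) - β j) * μ.real {ω | j + 1 ≤ V ω} := by
    simp_rw [h1]
    rw [integral_add (integrable_const _)
      (integrable_finsetSum _ fun j _ => (hint j).const_mul _), integral_const,
      integral_finsetSum _ fun j _ => (hint j).const_mul _]
    simp only [probReal_univ, smul_eq_mul, one_mul]
    congr 1
    refine Finset.sum_congr rfl fun j _ => ?_
    rw [integral_const_mul, integral_indicator_const _ (hms _), smul_eq_mul, mul_one]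
  rw [h2, ← summation_by_parts_upperTail, mul_add, Finset.mul_sum]
  refine add_le_add (by nlinarith) (Finset.sum_le_sum fun j hj => ?_)
  have hd : 0 ≤ β (j + 1) - β j := sub_nonneg.2 (hβ (Nat.le_succ j))
  calc _ ≤ (β (j + 1) - β j) * (R * upperTail L (j + 1)) := by
        gcongr; exact htail _ (Finset.mem_range.1 hj)
    _ = _ := by ring

end LayerCake

/-! ### Bounded measurable functions, for which integrability is automatic. -/

section BoundedMeasurable

variable {Ω : Type*} [MeasurableSpace Ω]

/-- Bounded measurable real functions. -/
def BoundedMeasurable (f : Ω → ℝ) : Prop := Measurable f ∧ ∃ C, ∀ ω, |f ω| ≤ C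

namespace BoundedMeasurable

variable {f g : Ω → ℝ}

lemma integrable (hf : BoundedMeasurable f) (μ : Measure Ω) [IsProbabilityMeasure μ] :
    Integrable f μ := by
  obtain ⟨hm, C, hC⟩ := hf
  exact Integrable.of_bound hm.aestronglyMeasurable C (ae_of_all _ hC)

lemma add (hf : BoundedMeasurable f) (hg : BoundedMeasurable g) :
    BoundedMeasurable fun ω => f ω + g ω := by
  obtain ⟨hm, C, hC⟩ := hf
  obtain ⟨hm', C', hC'⟩ := hg
  exact ⟨hm.add hm', C + C', fun ω => (abs_add_le _ _).trans (add_le_add (hC ω) (hC' ω))⟩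

lemma mul (hf : BoundedMeasurable f) (hg : BoundedMeasurable g) :
    BoundedMeasurable fun ω => f ω * g ω := by
  obtain ⟨hm, C, hC⟩ := hf
  obtain ⟨hm', C', hC'⟩ := hg
  refine ⟨hm.mul hm', C * C', fun ω => ?_⟩
  rw [abs_mul]
  exact mul_le_mul (hC ω) (hC' ω) (abs_nonneg _) ((abs_nonneg _).trans (hC ω))

lemma const (c : ℝ) : BoundedMeasurable fun _ : Ω => c :=
  ⟨measurable_const, |c|, fun _ => le_rfl⟩

lemma sub (hf : BoundedMeasurable f) (hg : BoundedMeasurable g) :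
    BoundedMeasurable fun ω => f ω - g ω := by
  simpa [sub_eq_add_neg] using hf.add ((const (-1)).mul hg)

lemma comp_nat {V : Ω → ℕ} (hV : Measurable V) {B : ℕ} (hB : ∀ ω, V ω ≤ B) (φ : ℕ → ℝ) :
    BoundedMeasurable fun ω => φ (V ω) := by
  refine ⟨(measurable_of_countable φ).comp hV, ∑ i ∈ Finset.range (B + 1), |φ i|, fun ω => ?_⟩
  exact Finset.single_le_sum (f := fun i => |φ i|) (fun i _ => abs_nonneg _)
    (Finset.mem_range.2 (Nat.lt_succ_of_le (hB ω)))

end BoundedMeasurable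

end BoundedMeasurable

/-! ### One-dependent arrays and factorization of expectations. -/

/-- The σ-algebra generated by the variables `Y j`, `j ∈ I`. -/
@[reducible] def sigmaOf {Ω : Type*} (Y : ℕ → Ω → ℕ) (I : Set ℕ) : MeasurableSpace Ω :=
  ⨆ j ∈ I, MeasurableSpace.comap (Y j) inferInstance

section SigmaOf

variable {Ω : Type*} [mΩ : MeasurableSpace Ω] {Y : ℕ → Ω → ℕ}

lemma sigmaOf_mono {I J : Set ℕ} (h : I ⊆ J) : sigmaOf Y I ≤ sigmaOf Y J :=
  biSup_mono h

lemma sigmaOf_le (hY : ∀ j, Measurable (Y j)) (I : Set ℕ) : sigmaOf Y I ≤ mΩ :=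
  iSup₂_le fun j _ => (hY j).comap_le

lemma measurable_sigmaOf {I : Set ℕ} {j : ℕ} (hj : j ∈ I) : Measurable[sigmaOf Y I] (Y j) :=
  (comap_measurable (Y j)).mono
    (le_iSup₂ (f := fun j (_ : j ∈ I) => MeasurableSpace.comap (Y j) inferInstance) j hj) le_rfl

lemma measurable_sigmaOf_sum {I : Set ℕ} {s : Finset ℕ} (hs : ∀ j ∈ s, j ∈ I) :
    Measurable[sigmaOf Y I] fun ω => ∑ j ∈ s, Y j ω :=
  @Finset.measurable_fun_sum _ _ _ _ _ _ (sigmaOf Y I) Y s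
    fun j hj => measurable_sigmaOf (hs j hj)

end SigmaOf

/-- A 1-dependent sequence of bounded variables, of which only those with index in
`{3, …, n + 2}` may be nonzero, with bounds for its moments. -/
structure IsOneDependentArray {Ω : Type*} [MeasurableSpace Ω] (μ : Measure Ω) (Y : ℕ → Ω → ℕ)
    (n K : ℕ) (ν ν₂ κ : ℝ) : Prop where
  meas : ∀ j, Measurable (Y j)
  bound : ∀ j ω, Y j ω ≤ K
  indep : ∀ s, Indep (sigmaOf Y (Set.Iio s)) (sigmaOf Y (Set.Ioi s)) μ
  eq_zero_of_lt : ∀ j < 3, ∀ ω, Y j ω = 0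
  eq_zero_of_ge : ∀ j, n + 3 ≤ j → ∀ ω, Y j ω = 0
  mean : ∀ k < n, ∫ ω, (Y (k + 3) ω : ℝ) ∂μ = ν
  mean_le : ∀ j, ∫ ω, (Y j ω : ℝ) ∂μ ≤ ν
  fact_le : ∀ j, ∫ ω, (Y j ω : ℝ) * ((Y j ω : ℝ) - 1) ∂μ ≤ ν₂
  mixed_le : ∀ j, ∫ ω, (Y j ω : ℝ) * (Y (j + 1) ω : ℝ) ∂μ ≤ κ

namespace IsOneDependentArray

variable {Ω : Type*} [mΩ : MeasurableSpace Ω] {μ : Measure Ω} [IsProbabilityMeasure μ]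
  {Y : ℕ → Ω → ℕ} {n K : ℕ} {ν ν₂ κ : ℝ}

lemma bddMeas (h : IsOneDependentArray μ Y n K ν ν₂ κ) (j : ℕ) :
    BoundedMeasurable fun ω => (Y j ω : ℝ) :=
  BoundedMeasurable.comp_nat (h.meas j) (h.bound j) fun i => (i : ℝ)

lemma measurable_sum (h : IsOneDependentArray μ Y n K ν ν₂ κ) (s : Finset ℕ) :
    Measurable fun ω => ∑ j ∈ s, Y j ω :=
  Finset.measurable_fun_sum s fun j _ => h.meas j

lemma sum_bound (h : IsOneDependentArray μ Y n K ν ν₂ κ) (s : Finset ℕ) (ω : Ω) :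
    ∑ j ∈ s, Y j ω ≤ s.card * K := by
  simpa using Finset.sum_le_card_nsmul s (fun j => Y j ω) K fun j _ => h.bound j ω

lemma nu_nonneg (h : IsOneDependentArray μ Y n K ν ν₂ κ) : 0 ≤ ν :=
  (integral_nonneg fun ω => Nat.cast_nonneg (Y 0 ω)).trans (h.mean_le 0)

lemma kappa_nonneg (h : IsOneDependentArray μ Y n K ν ν₂ κ) : 0 ≤ κ :=
  (integral_nonneg fun ω => mul_nonneg (Nat.cast_nonneg (Y 0 ω)) (Nat.cast_nonneg (Y 1 ω))).trans
    (h.mixed_le 0)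

lemma nat_mul_sub_one_nonneg (m : ℕ) : (0 : ℝ) ≤ (m : ℝ) * ((m : ℝ) - 1) := by
  rcases m with _ | m
  · simp
  · push_cast; simp; positivity

lemma nu₂_nonneg (h : IsOneDependentArray μ Y n K ν ν₂ κ) : 0 ≤ ν₂ :=
  (integral_nonneg fun ω => nat_mul_sub_one_nonneg (Y 0 ω)).trans (h.fact_le 0)

/-- Functions of the past and of the future of an index multiply in expectation. -/
lemma integral_mul_of_past_future (h : IsOneDependentArray μ Y n K ν ν₂ κ) {s : ℕ} {u v : Ω → ℝ}
    (hu : Measurable[sigmaOf Y (Set.Iio s)] u) (hv : Measurable[sigmaOf Y (Set.Ioi s)] v) :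
    ∫ ω, u ω * v ω ∂μ = (∫ ω, u ω ∂μ) * ∫ ω, v ω ∂μ := by
  have hi : IndepFun u v μ := by
    rw [IndepFun_iff_Indep]
    exact indep_of_indep_of_le_right (indep_of_indep_of_le_left (h.indep s) hu.comap_le) hv.comap_le
  exact hi.integral_fun_mul_eq_mul_integral
    (hu.mono (sigmaOf_le h.meas _) le_rfl).aestronglyMeasurable
    (hv.mono (sigmaOf_le h.meas _) le_rfl).aestronglyMeasurable

/-- A function of a block of indices is uncorrelated with functions of `P + F`, where `P` depends
on the indices below the block and `F` on those above it. -/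
lemma integral_mul_of_block (h : IsOneDependentArray μ Y n K ν ν₂ κ) {s t : ℕ} (hst : s < t)
    {u : Ω → ℝ} (hu : Measurable[sigmaOf Y (Set.Ioo s t)] u) (hub : BoundedMeasurable u)
    {P F : Finset ℕ} (hP : ∀ j ∈ P, j ∈ Set.Iio s) (hF : ∀ j ∈ F, j ∈ Set.Ioi t) (φ : ℕ → ℝ) :
    ∫ ω, u ω * φ (∑ j ∈ P, Y j ω + ∑ j ∈ F, Y j ω) ∂μ =
      (∫ ω, u ω ∂μ) * ∫ ω, φ (∑ j ∈ P, Y j ω + ∑ j ∈ F, Y j ω) ∂μ := by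
  set p : Ω → ℕ := fun ω => ∑ j ∈ P, Y j ω with hp
  set f : Ω → ℕ := fun ω => ∑ j ∈ F, Y j ω with hf
  set B := P.card * K
  have hpB : ∀ ω, p ω ≤ B := h.sum_bound P
  have hpm : Measurable[sigmaOf Y (Set.Iio s)] p := measurable_sigmaOf_sum hP
  have hfm : Measurable[sigmaOf Y (Set.Ioi t)] f := measurable_sigmaOf_sum hF
  have hfm' : Measurable[sigmaOf Y (Set.Ioi s)] f :=
    hfm.mono (sigmaOf_mono (Set.Ioi_subset_Ioi hst.le)) le_rfl
  -- `φ (p + f)` is not a product of past and future. Conditioning on the value `i` of `p` makes it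
  -- a sum of products, to which independence across `s` and then across `t` applies; the pieces are
  -- reassembled afterwards.
  let e : ℕ → Ω → ℝ := fun i ω => if p ω = i then 1 else 0
  have hem : ∀ i, Measurable[sigmaOf Y (Set.Iio s)] (e i) := fun i =>
    (measurable_of_countable fun m : ℕ => if m = i then (1 : ℝ) else 0).comp hpm
  have heb : ∀ i, BoundedMeasurable (e i) := fun i =>
    BoundedMeasurable.comp_nat (h.measurable_sum P) (h.sum_bound P)
      fun m : ℕ => if m = i then (1 : ℝ) else 0
  have hφb : ∀ i, BoundedMeasurable fun ω => φ (i + f ω) := fun i =>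
    BoundedMeasurable.comp_nat (h.measurable_sum F) (h.sum_bound F) fun m => φ (i + m)
  have hφm : ∀ i, Measurable[sigmaOf Y (Set.Ioi t)] fun ω => φ (i + f ω) := fun i =>
    (measurable_of_countable fun m : ℕ => φ (i + m)).comp hfm
  have hφm' : ∀ i, Measurable[sigmaOf Y (Set.Ioi s)] fun ω => φ (i + f ω) := fun i =>
    (measurable_of_countable fun m : ℕ => φ (i + m)).comp hfm'
  have hdec : ∀ ω, φ (p ω + f ω) = ∑ i ∈ Finset.range (B + 1), e i ω * φ (i + f ω) := by
    intro ω
    simp only [e, ite_mul, one_mul, zero_mul]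
    rw [Finset.sum_ite_eq, if_pos (Finset.mem_range.2 (Nat.lt_succ_of_le (hpB ω)))]
  have h1 : ∫ ω, u ω * φ (p ω + f ω) ∂μ =
      ∑ i ∈ Finset.range (B + 1), ∫ ω, e i ω * (u ω * φ (i + f ω)) ∂μ := by
    rw [← integral_finsetSum _ fun i _ => ((heb i).mul (hub.mul (hφb i))).integrable μ]
    refine integral_congr_ae (ae_of_all _ fun ω => ?_)
    simp only [hdec, Finset.mul_sum]
    exact Finset.sum_congr rfl fun i _ => by ring
  have h2 : ∫ ω, φ (p ω + f ω) ∂μ =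
      ∑ i ∈ Finset.range (B + 1), ∫ ω, e i ω * φ (i + f ω) ∂μ := by
    rw [← integral_finsetSum _ fun i _ => ((heb i).mul (hφb i)).integrable μ]
    exact integral_congr_ae (ae_of_all _ hdec)
  rw [h1, h2, Finset.mul_sum]
  refine Finset.sum_congr rfl fun i _ => ?_
  have hum : Measurable[sigmaOf Y (Set.Ioi s)] u :=
    hu.mono (sigmaOf_mono Set.Ioo_subset_Ioi_self) le_rfl
  have hum' : Measurable[sigmaOf Y (Set.Iio t)] u :=
    hu.mono (sigmaOf_mono Set.Ioo_subset_Iio_self) le_rfl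
  have huφ : Measurable[sigmaOf Y (Set.Ioi s)] fun ω => u ω * φ (i + f ω) :=
    Measurable.fun_mul (m := sigmaOf Y (Set.Ioi s)) hum (hφm' i)
  rw [h.integral_mul_of_past_future (hem i) huφ,
    h.integral_mul_of_past_future hum' (hφm i), h.integral_mul_of_past_future (hem i) (hφm' i)]
  ring

/-! ### Exponential moments of the sum. -/

section Chernoff

lemma pow_sub_one_le {e : ℝ} (he : 0 ≤ e) (m : ℕ) : (1 + e) ^ m - 1 ≤ m * e * (1 + e) ^ m := by
  induction m with
  | zero => simp
  | succ m ih =>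
    have h1 : 1 ≤ (1 + e) ^ (m + 1) := one_le_pow₀ (by linarith)
    have h2 : (1 + e) * ((1 + e) ^ m - 1) ≤ (1 + e) * (m * e * (1 + e) ^ m) := by gcongr
    have h3 : (1 + e) ^ (m + 1) = (1 + e) * (1 + e) ^ m := by ring
    have h4 : e * 1 ≤ e * (1 + e) ^ (m + 1) := by gcongr
    push_cast
    rw [h3] at h4 ⊢
    nlinarith

/-- The remainder carries `m (m - 1)`, so at second order only the factorial moment `ν₂` enters. -/
lemma pow_le_quadratic {e : ℝ} (he : 0 ≤ e) (m : ℕ) :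
    (1 + e) ^ m - 1 ≤ m * e + m * (m - 1) / 2 * e ^ 2 * (1 + e) ^ m := by
  induction m with
  | zero => simp
  | succ m ih =>
    have h1 : 1 ≤ (1 + e) ^ (m + 1) := one_le_pow₀ (by linarith)
    have h3 : (1 + e) ^ (m + 1) = (1 + e) * (1 + e) ^ m := by ring
    have h2 : (1 + e) * ((1 + e) ^ m - 1) ≤
        (1 + e) * (m * e + m * (m - 1) / 2 * e ^ 2 * (1 + e) ^ m) := by gcongr
    have h4 : (m : ℝ) * e ^ 2 * 1 ≤ m * e ^ 2 * (1 + e) ^ (m + 1) := by gcongr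
    push_cast
    rw [h3] at h4 ⊢
    nlinarith

/-- One step of the recursive bound for the generating function of the partial sums. -/
lemma integral_pow_step (h : IsOneDependentArray μ Y n K ν ν₂ κ) {e : ℝ} (he : 0 ≤ e) (j : ℕ) :
    ∫ ω, (1 + e) ^ (∑ i ∈ Finset.range (j + 3), Y i ω) ∂μ ≤
      (1 + (ν * e + ν₂ / 2 * e ^ 2 * (1 + e) ^ K + κ * e ^ 2 * (1 + e) ^ (3 * K))) *
        ∫ ω, (1 + e) ^ (∑ i ∈ Finset.range (j + 2), Y i ω) ∂μ := by
  have he1 : 1 ≤ 1 + e := by linarith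
  have hpos : 0 < 1 + e := by linarith
  set p : ℕ → Ω → ℝ := fun k ω => (1 + e) ^ (∑ i ∈ Finset.range k, Y i ω) with hp
  have hpb : ∀ k, BoundedMeasurable (p k) := fun k =>
    BoundedMeasurable.comp_nat (h.measurable_sum _) (h.sum_bound _) fun m => (1 + e) ^ m
  have hpm : ∀ k s, k ≤ s → Measurable[sigmaOf Y (Set.Iio s)] (p k) := fun k s hks =>
    (measurable_of_countable fun m : ℕ => (1 + e) ^ m).comp
      (measurable_sigmaOf_sum fun i hi => (Finset.mem_range.1 hi).trans_le hks)
  have hp1 : ∀ k ω, p (k + 1) ω = p k ω * (1 + e) ^ Y k ω := fun k ω => by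
    simp only [hp, Finset.sum_range_succ, pow_add]
  have hp0 : ∀ k ω, 0 < p k ω := fun k ω => by positivity
  have hpmono : ∀ k ω, p k ω ≤ p (k + 1) ω := fun k ω => by
    rw [hp1]; exact le_mul_of_one_le_right (hp0 k ω).le (one_le_pow₀ he1)
  have hKpow : ∀ i ω, (1 + e) ^ Y i ω ≤ (1 + e) ^ K := fun i ω =>
    pow_le_pow_right₀ he1 (h.bound i ω)
  -- Majorant of `(1 + e)^c - 1`, where `c` is the newest variable.
  set q : Ω → ℝ := fun ω => (Y (j + 2) ω : ℝ) * e +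
    (Y (j + 2) ω : ℝ) * ((Y (j + 2) ω : ℝ) - 1) * (e ^ 2 / 2 * (1 + e) ^ K) with hq
  set r : Ω → ℝ := fun ω => (Y (j + 1) ω : ℝ) * (Y (j + 2) ω : ℝ) with hr
  have hY2 := h.bddMeas (j + 2)
  have hqb : BoundedMeasurable q :=
    (hY2.mul (.const _)).add ((hY2.mul (hY2.sub (.const _))).mul (.const _))
  have hrb : BoundedMeasurable r := (h.bddMeas (j + 1)).mul hY2
  have hqm : Measurable[sigmaOf Y (Set.Ioi (j + 1))] q :=
    (measurable_of_countable fun m : ℕ => (m : ℝ) * e +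
      (m : ℝ) * ((m : ℝ) - 1) * (e ^ 2 / 2 * (1 + e) ^ K)).comp
      (measurable_sigmaOf (Set.mem_Ioi.2 (by omega)))
  have hYm : ∀ i, j < i → Measurable[sigmaOf Y (Set.Ioi j)] fun ω => (Y i ω : ℝ) := fun i hi =>
    (measurable_of_countable fun m : ℕ => (m : ℝ)).comp (measurable_sigmaOf (Set.mem_Ioi.2 hi))
  have hrm : Measurable[sigmaOf Y (Set.Ioi j)] r :=
    Measurable.fun_mul (m := sigmaOf Y (Set.Ioi j)) (hYm (j + 1) (by omega))
      (hYm (j + 2) (by omega))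
  have hpt : ∀ ω, p (j + 3) ω ≤
      p (j + 2) ω + p (j + 1) ω * q ω + p j ω * r ω * (e ^ 2 * (1 + e) ^ (3 * K)) := by
    intro ω
    set a := Y j ω
    set b := Y (j + 1) ω
    set c := Y (j + 2) ω
    have hA := pow_le_quadratic he c
    have hB := pow_sub_one_le he b
    have hC := pow_sub_one_le he c
    have hb1 : 1 ≤ (1 + e) ^ b := one_le_pow₀ he1
    have hc1 : 1 ≤ (1 + e) ^ c := one_le_pow₀ he1
    have hq' : (1 + e) ^ c - 1 ≤ q ω := by
      refine hA.trans ?_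
      have h0 := nat_mul_sub_one_nonneg c
      have : (c : ℝ) * (c - 1) / 2 * e ^ 2 * (1 + e) ^ c ≤
          (c : ℝ) * (c - 1) / 2 * e ^ 2 * (1 + e) ^ K := by
        gcongr ?_ * ?_; exact hKpow _ ω
      simp only [hq]
      linarith
    have hr' : (1 + e) ^ a * (((1 + e) ^ b - 1) * ((1 + e) ^ c - 1)) ≤
        r ω * (e ^ 2 * (1 + e) ^ (3 * K)) := by
      calc _ ≤ (1 + e) ^ K * ((b * e * (1 + e) ^ K) * (c * e * (1 + e) ^ K)) := by
            have hx : (1 + e) ^ b - 1 ≤ b * e * (1 + e) ^ K :=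
              hB.trans (by gcongr; exact h.bound _ ω)
            have hy : (1 + e) ^ c - 1 ≤ c * e * (1 + e) ^ K :=
              hC.trans (by gcongr; exact h.bound _ ω)
            have hb0 : 0 ≤ (1 + e) ^ b - 1 := by linarith
            have hc0 : 0 ≤ (1 + e) ^ c - 1 := by linarith
            gcongr
            exact h.bound _ ω
        _ = _ := by
            simp only [hr]
            rw [show 3 * K = K + K + K by ring, pow_add, pow_add]; ring
    -- The newest variable `c` depends on its neighbour `b`. Writing `(1 + e)^b = 1 + ((1 + e)^b -
    -- 1)` gives a term in which `b` is absent and a term with both deviations, of size `κ`. In the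
    -- first, `p (j + 1)` is separated from `c` by one index; in the second, `p j` is separated from
    -- `b` and `c` by the index of `a`, whose factor is bounded by `(1 + e)^K`.
    have e1 : p (j + 3) ω = p (j + 2) ω + p (j + 1) ω * ((1 + e) ^ c - 1) +
        p j ω * ((1 + e) ^ a * (((1 + e) ^ b - 1) * ((1 + e) ^ c - 1))) := by
      rw [hp1 (j + 2), hp1 (j + 1), hp1 j]; ring
    rw [e1, mul_assoc (p j ω)]
    have := (hp0 j ω).le
    have := (hp0 (j + 1) ω).le
    gcongr
  have hqi : ∫ ω, q ω ∂μ ≤ ν * e + ν₂ / 2 * e ^ 2 * (1 + e) ^ K := by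
    simp only [hq]
    rw [integral_add ((hY2.mul (.const _)).integrable μ)
      (((hY2.mul (hY2.sub (.const _))).mul (.const _)).integrable μ), integral_mul_const,
      integral_mul_const]
    have h1 : (∫ ω, (Y (j + 2) ω : ℝ) ∂μ) * e ≤ ν * e := by gcongr; exact h.mean_le _
    have h2 : (∫ ω, (Y (j + 2) ω : ℝ) * ((Y (j + 2) ω : ℝ) - 1) ∂μ) * (e ^ 2 / 2 * (1 + e) ^ K) ≤
        ν₂ * (e ^ 2 / 2 * (1 + e) ^ K) := by gcongr; exact h.fact_le _
    linarith
  have hri : ∫ ω, r ω ∂μ ≤ κ := h.mixed_le (j + 1)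
  have hint : ∫ ω, p (j + 3) ω ∂μ ≤ ∫ ω, p (j + 2) ω ∂μ + (∫ ω, p (j + 1) ω ∂μ) * ∫ ω, q ω ∂μ +
      (∫ ω, p j ω ∂μ) * (∫ ω, r ω ∂μ) * (e ^ 2 * (1 + e) ^ (3 * K)) := by
    have i1 := (hpb (j + 2)).integrable μ
    have i2 := ((hpb (j + 1)).mul hqb).integrable μ
    have i3 := (((hpb j).mul hrb).mul (.const (e ^ 2 * (1 + e) ^ (3 * K)))).integrable μ
    have i12 : Integrable (fun ω => p (j + 2) ω + p (j + 1) ω * q ω) μ := i1.add i2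
    refine (integral_mono ((hpb (j + 3)).integrable μ) (i12.add i3) hpt).trans (le_of_eq ?_)
    simp only [Pi.add_apply]
    rw [integral_add i12 i3, integral_add i1 i2, integral_mul_const,
      h.integral_mul_of_past_future (hpm (j + 1) (j + 1) le_rfl) hqm,
      h.integral_mul_of_past_future (hpm j j le_rfl) hrm]
  have hP : ∀ k, 0 ≤ ∫ ω, p k ω ∂μ := fun k => integral_nonneg fun ω => (hp0 k ω).le
  have hPm : ∀ k, ∫ ω, p k ω ∂μ ≤ ∫ ω, p (k + 1) ω ∂μ := fun k =>
    integral_mono ((hpb k).integrable μ) ((hpb (k + 1)).integrable μ) (hpmono k)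
  have hν := h.nu_nonneg
  have hν₂ := h.nu₂_nonneg
  have hκ := h.kappa_nonneg
  have hP2 := hPm (j + 1)
  have hP1 := (hPm j).trans hP2
  refine hint.trans ?_
  calc _ ≤ ∫ ω, p (j + 2) ω ∂μ +
        (∫ ω, p (j + 2) ω ∂μ) * (ν * e + ν₂ / 2 * e ^ 2 * (1 + e) ^ K) +
        (∫ ω, p (j + 2) ω ∂μ) * κ * (e ^ 2 * (1 + e) ^ (3 * K)) := by
        gcongr ?_ + ?_ + ?_
        · exact le_rfl
        · refine (mul_le_mul_of_nonneg_left hqi (hP (j + 1))).trans ?_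
          gcongr
        · refine mul_le_mul_of_nonneg_right ?_ (by positivity)
          refine (mul_le_mul_of_nonneg_left hri (hP j)).trans ?_
          gcongr
    _ = _ := by ring

lemma integral_pow_le (h : IsOneDependentArray μ Y n K ν ν₂ κ) {e : ℝ} (he : 0 ≤ e) (m : ℕ) :
    ∫ ω, (1 + e) ^ (∑ i ∈ Finset.range (m + 3), Y i ω) ∂μ ≤
      (1 + (ν * e + ν₂ / 2 * e ^ 2 * (1 + e) ^ K + κ * e ^ 2 * (1 + e) ^ (3 * K))) ^ m := by
  have hν := h.nu_nonneg
  have hν₂ := h.nu₂_nonneg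
  have hκ := h.kappa_nonneg
  induction m with
  | zero =>
    have : ∀ ω, ∑ i ∈ Finset.range (0 + 3), Y i ω = 0 := fun ω =>
      Finset.sum_eq_zero fun i hi => h.eq_zero_of_lt i (by simpa using hi) ω
    simp [this]
  | succ m ih =>
    rw [pow_succ']
    refine (h.integral_pow_step he (m + 1)).trans ?_
    exact mul_le_mul_of_nonneg_left ih (by positivity)

lemma sum_range_add_six (h : IsOneDependentArray μ Y n K ν ν₂ κ) (ω : Ω) :
    ∑ i ∈ Finset.range (n + 6), Y i ω = ∑ i ∈ Finset.range (n + 3), Y i ω := by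
  rw [Finset.sum_range_succ, Finset.sum_range_succ, Finset.sum_range_succ,
    h.eq_zero_of_ge (n + 3) (by omega), h.eq_zero_of_ge (n + 3 + 1) (by omega),
    h.eq_zero_of_ge (n + 3 + 1 + 1) (by omega)]
  rfl

lemma sum_range_eq (h : IsOneDependentArray μ Y n K ν ν₂ κ) (ω : Ω) :
    ∑ i ∈ Finset.range (n + 6), Y i ω = ∑ k ∈ Finset.range n, Y (k + 3) ω := by
  rw [h.sum_range_add_six, Finset.sum_range_succ', Finset.sum_range_succ', Finset.sum_range_succ',
    h.eq_zero_of_lt 0 (by omega), h.eq_zero_of_lt (0 + 1) (by omega),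
    h.eq_zero_of_lt (0 + 1 + 1) (by omega)]
  rfl

/-- The Chernoff bound. -/
lemma measure_ge_mul_pow_le (h : IsOneDependentArray μ Y n K ν ν₂ κ) {e : ℝ} (he : 0 ≤ e) (x : ℕ) :
    μ.real {ω | x ≤ ∑ i ∈ Finset.range (n + 6), Y i ω} * (1 + e) ^ x ≤
      (1 + (ν * e + ν₂ / 2 * e ^ 2 * (1 + e) ^ K + κ * e ^ 2 * (1 + e) ^ (3 * K))) ^ n := by
  refine le_trans ?_ (h.integral_pow_le he n)
  have he1 : 1 ≤ 1 + e := by linarith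
  have hm : MeasurableSet {ω | x ≤ ∑ i ∈ Finset.range (n + 6), Y i ω} :=
    h.measurable_sum _ (measurableSet_Ici (a := x))
  have hb : BoundedMeasurable fun ω => (1 + e) ^ (∑ i ∈ Finset.range (n + 3), Y i ω) :=
    BoundedMeasurable.comp_nat (h.measurable_sum _) (h.sum_bound _) fun m => (1 + e) ^ m
  rw [← smul_eq_mul, ← integral_indicator_const _ hm]
  refine integral_mono ((integrable_const _).indicator hm) (hb.integrable μ) fun ω => ?_
  simp only [← h.sum_range_add_six]
  by_cases hω : x ≤ ∑ i ∈ Finset.range (n + 6), Y i ω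
  · rw [Set.indicator_of_mem (by exact hω)]
    exact pow_le_pow_right₀ he1 hω
  · rw [Set.indicator_of_notMem (by exact hω)]
    positivity

end Chernoff

end IsOneDependentArray

/-! ### Poisson tails under a shift of the point. -/

section Poisson

variable {L : ℝ}

lemma poissonWeight_sub_le (hL : 0 < L) {j : ℕ} (hj : j ≤ 1.1 * L) (m : ℕ) (hm : m ≤ j) :
    poissonWeight L (j - m) ≤ 1.1 ^ m * poissonWeight L j := by
  induction m with
  | zero => simp
  | succ m ih =>
    have ih := ih (by omega)
    obtain ⟨i, hi⟩ : ∃ i, j - m = i + 1 := ⟨j - m - 1, by omega⟩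
    have hi' : j - (m + 1) = i := by omega
    rw [hi']
    rw [hi] at ih
    have h1 := poissonWeight_succ L i
    have h2 : (i : ℝ) + 1 ≤ 1.1 * L := by
      have : i + 1 ≤ j := by omega
      have : ((i : ℝ) + 1) ≤ j := by exact_mod_cast this
      linarith
    have h3 : L * poissonWeight L i ≤ L * (1.1 * poissonWeight L (i + 1)) := by
      rw [← h1]
      nlinarith [poissonWeight_pos hL (i + 1)]
    have h4 := le_of_mul_le_mul_left h3 hL
    rw [pow_succ]
    linarith

/-- Each step down adds a weight at most `1.1` times the previous bound, and `1 + 1.1 + ⋯ + 1.1^m =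
11 * 1.1 ^ m - 10`. -/
lemma upperTail_sub_le_mul (hL : 0 < L) {j : ℕ} (hj : j ≤ 1.1 * L) (m : ℕ) :
    upperTail L (j - m) ≤ (11 * 1.1 ^ m - 10) * upperTail L j := by
  induction m with
  | zero => norm_num
  | succ m ih =>
    have hT := upperTail_nonneg hL j
    have h1 : (1 : ℝ) ≤ 1.1 ^ m := one_le_pow₀ (by norm_num)
    have h0 : (11 * 1.1 ^ (m + 1) - 10 : ℝ) = (11 * 1.1 ^ m - 10) + 1.1 * 1.1 ^ m := by
      rw [pow_succ]; ring
    rw [h0, add_mul]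
    rcases lt_or_ge m j with h | h
    · obtain ⟨i, hi⟩ : ∃ i, j - m = i + 1 := ⟨j - m - 1, by omega⟩
      have hi' : j - (m + 1) = i := by omega
      have hw := poissonWeight_sub_le hL hj (m + 1) (by omega)
      have hs := upperTail_succ L i
      rw [hi'] at hw ⊢
      rw [hi] at ih
      have h5 : 1.1 ^ (m + 1) * poissonWeight L j ≤ 1.1 ^ (m + 1) * upperTail L j := by
        gcongr; exact poissonWeight_le_upperTail hL j
      rw [pow_succ] at hw h5
      linarith
    · have : j - (m + 1) = j - m := by omega
      rw [this]
      nlinarith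

end Poisson

/-! ### The Stein-Chen error for one-dependent arrays. -/

namespace IsOneDependentArray

variable {Ω : Type*} [mΩ : MeasurableSpace Ω] {μ : Measure Ω} [IsProbabilityMeasure μ]
  {Y : ℕ → Ω → ℕ} {n K : ℕ} {ν ν₂ κ : ℝ}

/-- The window of five indices is centred at `k + 3`. The zero padding on both sides provides it for
every `k < n`, with no boundary cases. -/
lemma sum_range_split (ω : Ω) {k : ℕ} (hk : k < n) :
    ∑ i ∈ Finset.range (n + 6), Y i ω = (∑ i ∈ Finset.range (k + 1), Y i ω +
      ∑ i ∈ Finset.Ico (k + 6) (n + 6), Y i ω) + Y (k + 1) ω + Y (k + 2) ω + Y (k + 3) ω +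
      Y (k + 4) ω + Y (k + 5) ω := by
  rw [← Finset.sum_range_add_sum_Ico _ (show k + 6 ≤ n + 6 by omega), Finset.sum_range_succ,
    Finset.sum_range_succ, Finset.sum_range_succ, Finset.sum_range_succ, Finset.sum_range_succ]
  ring

lemma sum_range_split' (ω : Ω) {k : ℕ} (hk : k < n) :
    ∑ i ∈ Finset.range (n + 6), Y i ω = (∑ i ∈ Finset.range (k + 2), Y i ω +
      ∑ i ∈ Finset.Ico (k + 5) (n + 6), Y i ω) + Y (k + 2) ω + Y (k + 3) ω +
      Y (k + 4) ω := by
  rw [← Finset.sum_range_add_sum_Ico _ (show k + 5 ≤ n + 6 by omega), Finset.sum_range_succ,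
    Finset.sum_range_succ, Finset.sum_range_succ]
  ring

/-- The contribution of one summand to the Stein-Chen error. -/
lemma abs_integral_summand_le (h : IsOneDependentArray μ Y n K ν ν₂ κ) {L : ℝ} (hL : 0 < L)
    {x : ℕ} (hx : L < x) {k : ℕ} (hk : k < n) :
    |∫ ω, ((Y (k + 3) ω : ℝ) * steinSol L x (∑ i ∈ Finset.range (n + 6), Y i ω) -
        ν * steinSol L x (∑ i ∈ Finset.range (n + 6), Y i ω + 1)) ∂μ| ≤
      (2 * κ + ν₂ + 3 * ν ^ 2) / L * ∫ ω, steinEnvelope L x ((∑ i ∈ Finset.range (k + 1), Y i ω +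
        ∑ i ∈ Finset.Ico (k + 6) (n + 6), Y i ω) + 5 * K) ∂μ := by
  set g := steinSol L x with hg
  set S : Ω → ℕ := fun ω => ∑ i ∈ Finset.range (n + 6), Y i ω with hS
  -- `W` omits the indices `k + 2, k + 3, k + 4` and is independent of the middle variable. `V` also
  -- omits `k + 1` and `k + 5` and is independent of the whole block of three.
  set W : Ω → ℕ := fun ω => ∑ i ∈ Finset.range (k + 2), Y i ω +
      ∑ i ∈ Finset.Ico (k + 5) (n + 6), Y i ω with hW
  set V : Ω → ℕ := fun ω => ∑ i ∈ Finset.range (k + 1), Y i ω +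
      ∑ i ∈ Finset.Ico (k + 6) (n + 6), Y i ω with hV
  set D : Ω → ℝ := fun ω => steinEnvelope L x (V ω + 5 * K) with hD
  have hν := h.nu_nonneg
  have hSb : ∀ φ : ℕ → ℝ, BoundedMeasurable fun ω => φ (S ω) := fun φ =>
    BoundedMeasurable.comp_nat (h.measurable_sum _) (h.sum_bound _) φ
  have hWb : ∀ φ : ℕ → ℝ, BoundedMeasurable fun ω => φ (W ω) := fun φ =>
    BoundedMeasurable.comp_nat ((h.measurable_sum _).add (h.measurable_sum _))
      (fun ω => add_le_add (h.sum_bound _ ω) (h.sum_bound _ ω)) φ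
  have hVb : ∀ φ : ℕ → ℝ, BoundedMeasurable fun ω => φ (V ω) := fun φ =>
    BoundedMeasurable.comp_nat ((h.measurable_sum _).add (h.measurable_sum _))
      (fun ω => add_le_add (h.sum_bound _ ω) (h.sum_bound _ ω)) φ
  have hDb : BoundedMeasurable D := hVb fun v => steinEnvelope L x (v + 5 * K)
  have hD0 : ∀ ω, 0 ≤ D ω := fun ω => steinEnvelope_nonneg hL x _
  have h2 := h.bddMeas (k + 2)
  have h3 := h.bddMeas (k + 3)
  have h4 := h.bddMeas (k + 4)
  set m₁ : Ω → ℝ := fun ω => (Y (k + 3) ω : ℝ) *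
    ((Y (k + 2) ω : ℝ) + ((Y (k + 3) ω : ℝ) - 1) + (Y (k + 4) ω : ℝ)) with hm₁
  set m₂ : Ω → ℝ := fun ω =>
    (Y (k + 2) ω : ℝ) + (Y (k + 3) ω : ℝ) + (Y (k + 4) ω : ℝ) with hm₂
  have hm₁b : BoundedMeasurable m₁ := h3.mul ((h2.add (h3.sub (.const 1))).add h4)
  have hm₂b : BoundedMeasurable m₂ := (h2.add h3).add h4
  have hmeas : ∀ i, k + 1 < i → i < k + 5 →
      Measurable[sigmaOf Y (Set.Ioo (k + 1) (k + 5))] fun ω => (Y i ω : ℝ) := fun i hi hi' =>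
    (measurable_of_countable fun m : ℕ => (m : ℝ)).comp (measurable_sigmaOf ⟨hi, hi'⟩)
  have e2 := hmeas (k + 2) (by omega) (by omega)
  have e3 := hmeas (k + 3) (by omega) (by omega)
  have e4 := hmeas (k + 4) (by omega) (by omega)
  have hm₁m : Measurable[sigmaOf Y (Set.Ioo (k + 1) (k + 5))] m₁ :=
    Measurable.fun_mul (m := sigmaOf Y (Set.Ioo (k + 1) (k + 5))) e3
      (Measurable.fun_add (m := sigmaOf Y (Set.Ioo (k + 1) (k + 5)))
        (Measurable.fun_add (m := sigmaOf Y (Set.Ioo (k + 1) (k + 5))) e2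
          (e3.sub_const 1)) e4)
  have hm₂m : Measurable[sigmaOf Y (Set.Ioo (k + 1) (k + 5))] m₂ :=
    Measurable.fun_add (m := sigmaOf Y (Set.Ioo (k + 1) (k + 5)))
      (Measurable.fun_add (m := sigmaOf Y (Set.Ioo (k + 1) (k + 5))) e2 e3) e4
  have hdec : ∀ u, Measurable[sigmaOf Y (Set.Ioo (k + 1) (k + 5))] u → BoundedMeasurable u →
      ∫ ω, u ω * D ω ∂μ = (∫ ω, u ω ∂μ) * ∫ ω, D ω ∂μ := fun u hu hub =>
    h.integral_mul_of_block (by omega) hu hub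
      (fun j hj => Set.mem_Iio.2 (Finset.mem_range.1 hj))
      (fun j hj => Set.mem_Ioi.2 (by have := (Finset.mem_Ico.1 hj).1; omega))
      fun v => steinEnvelope L x (v + 5 * K)
  -- By this identity, `g (W + 1)` can be inserted in both terms of the summand; only increments of
  -- `g` remain.
  have hmid : ∫ ω, (Y (k + 3) ω : ℝ) * g (W ω + 1) ∂μ = ν * ∫ ω, g (W ω + 1) ∂μ := by
    rw [← h.mean k hk]
    exact h.integral_mul_of_block (s := k + 2) (t := k + 4) (by omega)
      ((measurable_of_countable fun m : ℕ => (m : ℝ)).comp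
        (measurable_sigmaOf ⟨by omega, by omega⟩)) h3
      (fun j hj => Set.mem_Iio.2 (Finset.mem_range.1 hj))
      (fun j hj => Set.mem_Ioi.2 (by have := (Finset.mem_Ico.1 hj).1; omega))
      fun v => g (v + 1)
  have hWS : ∀ ω, S ω = W ω + Y (k + 2) ω + Y (k + 3) ω + Y (k + 4) ω := fun ω =>
    sum_range_split' ω hk
  have hSV : ∀ ω, S ω ≤ V ω + 5 * K := by
    intro ω
    have := sum_range_split (Y := Y) ω hk
    have := h.bound (k + 1) ω
    have := h.bound (k + 2) ω
    have := h.bound (k + 3) ω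
    have := h.bound (k + 4) ω
    have := h.bound (k + 5) ω
    simp only [hS, hV]
    omega
  -- When the middle variable is positive, `W + 1 ≤ S`, and the number of unit steps from `W + 1` to
  -- `S` times that variable is `m₁`. When it is zero both sides vanish. The envelope is evaluated
  -- at `V + 5 * K ≥ S`, which no longer involves the block.
  have hpt₁ : ∀ ω, |(Y (k + 3) ω : ℝ) * (g (S ω) - g (W ω + 1))| ≤ m₁ ω * D ω * (1 / L) := by
    intro ω
    rcases Nat.eq_zero_or_pos (Y (k + 3) ω) with h0 | h0
    · simp [hm₁, h0]
    · have := abs_steinSol_sub_le hL hx (a := W ω + 1) (b := S ω) (c := V ω + 5 * K)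
        (by have := hWS ω; omega) ((hSV ω).trans (Nat.le_succ _))
      rw [abs_mul, abs_of_nonneg (Nat.cast_nonneg _)]
      calc _ ≤ (Y (k + 3) ω : ℝ) * (((S ω : ℕ) - (W ω + 1 : ℕ) : ℝ) *
            (steinEnvelope L x (V ω + 5 * K) / L)) := by gcongr
        _ = _ := by
          simp only [hm₁, hD]
          rw [hWS ω]
          push_cast
          ring
  have hpt₂ : ∀ ω, |g (W ω + 1) - g (S ω + 1)| ≤ m₂ ω * D ω * (1 / L) := by
    intro ω
    have h5 : |g (W ω + 1) - g (S ω + 1)| ≤ ((S ω + 1 : ℕ) - (W ω + 1 : ℕ) : ℝ) * (D ω / L) := by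
      rw [abs_sub_comm]
      exact abs_steinSol_sub_le hL hx (by have := hWS ω; omega) (Nat.succ_le_succ (hSV ω))
    refine h5.trans (le_of_eq ?_)
    simp only [hm₂]
    rw [hWS ω]
    push_cast
    ring
  have hgW := hWb fun v => g (v + 1)
  have hgS := hSb fun v => g (v + 1)
  have hgS0 := hSb g
  have hA : BoundedMeasurable fun ω => (Y (k + 3) ω : ℝ) * (g (S ω) - g (W ω + 1)) :=
    h3.mul (hgS0.sub hgW)
  have hB := hgW.sub hgS
  have hdecomp : ∫ ω, ((Y (k + 3) ω : ℝ) * g (S ω) - ν * g (S ω + 1)) ∂μ =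
      ∫ ω, (Y (k + 3) ω : ℝ) * (g (S ω) - g (W ω + 1)) ∂μ +
        ν * ∫ ω, (g (W ω + 1) - g (S ω + 1)) ∂μ := by
    rw [integral_sub (hgW.integrable μ) (hgS.integrable μ), mul_sub, ← hmid, ← integral_const_mul,
      ← integral_sub ((h3.mul hgW).integrable μ) (((BoundedMeasurable.const ν).mul hgS).integrable μ),
      ← integral_add (hA.integrable μ)
        (((h3.mul hgW).sub ((BoundedMeasurable.const ν).mul hgS)).integrable μ)]
    exact integral_congr_ae (ae_of_all _ fun ω => by ring)
  have hI₁ : ∫ ω, m₁ ω ∂μ ≤ 2 * κ + ν₂ := by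
    have hsplit : ∀ ω, m₁ ω = ((Y (k + 2) ω : ℝ) * (Y (k + 3) ω : ℝ) +
        (Y (k + 3) ω : ℝ) * ((Y (k + 3) ω : ℝ) - 1)) + (Y (k + 3) ω : ℝ) * (Y (k + 4) ω : ℝ) :=
      fun ω => by simp only [hm₁]; ring
    have b1 := h2.mul h3
    have b2 := h3.mul (h3.sub (.const 1))
    have b3 := h3.mul h4
    simp_rw [hsplit]
    rw [integral_add ((b1.add b2).integrable μ) (b3.integrable μ),
      integral_add (b1.integrable μ) (b2.integrable μ)]
    have c1 := h.mixed_le (k + 2)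
    have c2 := h.fact_le (k + 3)
    have c3 := h.mixed_le (k + 3)
    simp only [add_assoc, Nat.reduceAdd] at c1 c2 c3 ⊢
    linarith
  have hI₂ : ∫ ω, m₂ ω ∂μ ≤ 3 * ν := by
    simp only [hm₂]
    rw [integral_add ((h2.add h3).integrable μ) (h4.integrable μ),
      integral_add (h2.integrable μ) (h3.integrable μ)]
    linarith [h.mean_le (k + 2), h.mean_le (k + 3), h.mean_le (k + 4)]
  have hDi : 0 ≤ ∫ ω, D ω ∂μ := integral_nonneg hD0
  have hJ₁ : |∫ ω, (Y (k + 3) ω : ℝ) * (g (S ω) - g (W ω + 1)) ∂μ| ≤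
      (2 * κ + ν₂) * (∫ ω, D ω ∂μ) * (1 / L) := by
    refine abs_integral_le_integral_abs.trans ?_
    refine (integral_mono (hA.integrable μ).abs
      (((hm₁b.mul hDb).mul (.const (1 / L))).integrable μ) hpt₁).trans ?_
    rw [integral_mul_const, hdec m₁ hm₁m hm₁b]
    gcongr
  have hJ₂ : |∫ ω, (g (W ω + 1) - g (S ω + 1)) ∂μ| ≤ 3 * ν * (∫ ω, D ω ∂μ) * (1 / L) := by
    refine abs_integral_le_integral_abs.trans ?_
    refine (integral_mono (hB.integrable μ).abs
      (((hm₂b.mul hDb).mul (.const (1 / L))).integrable μ) hpt₂).trans ?_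
    rw [integral_mul_const, hdec m₂ hm₂m hm₂b]
    gcongr
  rw [hdecomp]
  calc _ ≤ (2 * κ + ν₂) * (∫ ω, D ω ∂μ) * (1 / L) +
        ν * (3 * ν * (∫ ω, D ω ∂μ) * (1 / L)) := by
        refine (abs_add_le _ _).trans (add_le_add hJ₁ ?_)
        rw [abs_mul, abs_of_nonneg hν]
        gcongr
    _ = _ := by ring

/-- The Stein-Chen comparison of tails, given an a priori bound for the ratio of tails. -/
lemma abs_measure_sub_upperTail_le (h : IsOneDependentArray μ Y n K ν ν₂ κ) (hN : 0 < n * ν)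
    {x : ℕ} (hx : n * ν < x) (hx' : x ≤ 1.1 * (n * ν)) {M : ℝ} (hM : 1 ≤ M)
    (htail : ∀ j ≤ x, μ.real {ω | j ≤ ∑ i ∈ Finset.range (n + 6), Y i ω} ≤
      M * upperTail (n * ν) j) :
    |μ.real {ω | x ≤ ∑ i ∈ Finset.range (n + 6), Y i ω} - upperTail (n * ν) x| ≤
      n * ((2 * κ + ν₂ + 3 * ν ^ 2) / (n * ν) * (M * (11 * 1.1 ^ (5 * K)) *
        (upperTail (n * ν) x * (3 + (x - n * ν) ^ 2 / (n * ν))))) := by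
  set L : ℝ := n * ν with hL
  have hν := h.nu_nonneg
  have hν₂ := h.nu₂_nonneg
  have hκ := h.kappa_nonneg
  have hx0 : 0 < x := by exact_mod_cast hN.trans hx
  set S : Ω → ℕ := fun ω => ∑ i ∈ Finset.range (n + 6), Y i ω with hS
  have hSb : ∀ φ : ℕ → ℝ, BoundedMeasurable fun ω => φ (S ω) := fun φ =>
    BoundedMeasurable.comp_nat (h.measurable_sum _) (h.sum_bound _) φ
  have hSm : MeasurableSet {ω | x ≤ S ω} := h.measurable_sum _ (measurableSet_Ici (a := x))
  have hT : ∀ j, 0 ≤ upperTail L j := upperTail_nonneg hN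
  -- The summands add up to `S g(S) - L g(S + 1)`, the left side of the Stein equation evaluated at
  -- `S`.
  have hstein : μ.real {ω | x ≤ S ω} - upperTail L x = ∑ k ∈ Finset.range n,
      ∫ ω, ((Y (k + 3) ω : ℝ) * steinSol L x (S ω) - ν * steinSol L x (S ω + 1)) ∂μ := by
    rw [← integral_finsetSum _ fun k _ => (((h.bddMeas (k + 3)).mul (hSb _)).sub
      ((BoundedMeasurable.const ν).mul (hSb fun v => steinSol L x (v + 1)))).integrable μ]
    have h1 : ∀ ω, ∑ k ∈ Finset.range n, ((Y (k + 3) ω : ℝ) * steinSol L x (S ω) -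
        ν * steinSol L x (S ω + 1)) = {ω | x ≤ S ω}.indicator (fun _ => (1 : ℝ)) ω -
          upperTail L x := by
      intro ω
      rw [Finset.sum_sub_distrib, ← Finset.sum_mul, Finset.sum_const, Finset.card_range,
        nsmul_eq_mul, ← mul_assoc, ← hL, ← Nat.cast_sum, ← h.sum_range_eq ω,
        steinSol_equation hN hx0]
      simp [Set.indicator_apply, hS]
    simp_rw [h1]
    rw [integral_sub ((integrable_const _).indicator hSm) (integrable_const _),
      integral_indicator_const _ hSm]
    simp
  have hterm : ∀ k ∈ Finset.range n,
      |∫ ω, ((Y (k + 3) ω : ℝ) * steinSol L x (S ω) - ν * steinSol L x (S ω + 1)) ∂μ| ≤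
      (2 * κ + ν₂ + 3 * ν ^ 2) / L * (M * (11 * 1.1 ^ (5 * K)) *
        (upperTail L x * (3 + (x - L) ^ 2 / L))) := by
    intro k hk
    have hk := Finset.mem_range.1 hk
    refine (h.abs_integral_summand_le hN hx hk).trans ?_
    have hρ : (1 : ℝ) ≤ 1.1 ^ (5 * K) := one_le_pow₀ (by norm_num)
    gcongr
    refine (integral_monotone_le (L := L) (steinEnvelope_monotone hN hx) (steinEnvelope_nonneg hN x 0)
      (x := x) (fun j hj => by simp [steinEnvelope, not_lt.2 hj])
      (V := fun ω => (∑ i ∈ Finset.range (k + 1), Y i ω +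
        ∑ i ∈ Finset.Ico (k + 6) (n + 6), Y i ω) + 5 * K)
      (((h.measurable_sum _).add (h.measurable_sum _)).add_const _)
      (R := M * (11 * 1.1 ^ (5 * K))) (by nlinarith) ?_).trans ?_
    · intro j hj
      have hjx : (j : ℝ) ≤ x := by exact_mod_cast hj
      -- `V ≤ S`, so a large `V + 5 * K` forces a large `S`. The shift by `5 * K` is then undone on
      -- the Poisson side at the cost of the factor `11 * 1.1 ^ (5 * K)`.
      calc _ ≤ μ.real {ω | j - 5 * K ≤ S ω} := by
            refine measureReal_mono fun ω hω => ?_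
            have := sum_range_split (Y := Y) ω hk
            simp only [Set.mem_ofPred_eq, hS] at hω ⊢
            omega
        _ ≤ M * upperTail L (j - 5 * K) := htail _ ((Nat.sub_le _ _).trans hj)
        _ ≤ M * ((11 * 1.1 ^ (5 * K) - 10) * upperTail L j) := by
            gcongr; exact upperTail_sub_le_mul hN (hjx.trans hx') _
        _ ≤ _ := by
            rw [mul_assoc]
            have := hT j
            gcongr
            linarith
    · have := sum_steinEnvelope_le hN hx
      gcongr
  rw [hstein]
  refine (Finset.abs_sum_le_sum_abs _ _).trans ((Finset.sum_le_sum hterm).trans (le_of_eq ?_))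
  rw [Finset.sum_const, Finset.card_range, nsmul_eq_mul]

end IsOneDependentArray

/-! ### Bootstrap for the ratio of tails, and the Chernoff bound in terms of `γ`. -/

namespace IsOneDependentArray

variable {Ω : Type*} [mΩ : MeasurableSpace Ω] {μ : Measure Ω} [IsProbabilityMeasure μ]
  {Y : ℕ → Ω → ℕ} {n K : ℕ} {ν ν₂ κ : ℝ}

/-- Since `1.1 ≤ e^{1/10}`, the powers with exponent a multiple of `K` are absorbed by the factor
`e^{1.5 C₀}` in `γ`. -/
lemma pow_le_exp_mul {h C₀ b : ℝ} {m : ℕ} (hh : 0 ≤ h) (hh' : h ≤ 1.1) (hm : m / 10 ≤ b * C₀) :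
    h ^ m ≤ Real.exp (b * C₀) := by
  have h1 : h ≤ Real.exp (1 / 10) := by
    have := Real.add_one_le_exp (1 / 10 : ℝ); linarith
  calc h ^ m ≤ Real.exp (1 / 10) ^ m := by gcongr
    _ = Real.exp (m / 10) := by rw [← Real.exp_nat_mul]; congr 1; ring
    _ ≤ _ := Real.exp_le_exp.2 hm

/-- The Stein-Chen comparison with the moments collected into one coefficient. -/
lemma abs_measure_sub_upperTail_le_coeff (h : IsOneDependentArray μ Y n K ν ν₂ κ) {C₀ γ M : ℝ}
    (hK : (K : ℝ) ≤ C₀) (hC₀ : 1 ≤ C₀) (hγ₁ : Real.exp (1.5 * C₀) * ν ^ 2 ≤ γ)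
    (hγ₂ : Real.exp (1.5 * C₀) * ν₂ ≤ γ) (hγ₃ : Real.exp (1.5 * C₀) * κ ≤ γ)
    (hN : 0 < n * ν) {x : ℕ} (hx : n * ν < x) (hx' : x ≤ 1.1 * (n * ν)) (hM : 1 ≤ M)
    (htail : ∀ j ≤ x, μ.real {ω | j ≤ ∑ i ∈ Finset.range (n + 6), Y i ω} ≤
      M * upperTail (n * ν) j) :
    |μ.real {ω | x ≤ ∑ i ∈ Finset.range (n + 6), Y i ω} - upperTail (n * ν) x| ≤
      198 * (γ / ν * (1 + (x - n * ν) ^ 2 / (n * ν))) * M * upperTail (n * ν) x := by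
  have hν := h.nu_nonneg
  have hν0 : ν ≠ 0 := by rintro rfl; simp at hN
  have hνp : 0 < ν := lt_of_le_of_ne hν hν0.symm
  have hn : (n : ℝ) ≠ 0 := by intro h0; simp [h0] at hN
  have hν₂ := h.nu₂_nonneg
  have hκ := h.kappa_nonneg
  have hT := upperTail_nonneg hN x
  have hE : (1.1 : ℝ) ^ (5 * K) ≤ Real.exp (1.5 * C₀) :=
    pow_le_exp_mul (by norm_num) le_rfl (by push_cast; linarith)
  have hs : (2 * κ + ν₂ + 3 * ν ^ 2) * 1.1 ^ (5 * K) ≤ 6 * γ := by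
    calc _ ≤ (2 * κ + ν₂ + 3 * ν ^ 2) * Real.exp (1.5 * C₀) := by gcongr
      _ ≤ _ := by linarith
  have hγ0 : 0 ≤ γ := le_trans (by positivity) hγ₁
  have hq : 0 ≤ (x - n * ν) ^ 2 / (n * ν) := by positivity
  refine (h.abs_measure_sub_upperTail_le hN hx hx' hM htail).trans ?_
  set q := (x - n * ν) ^ 2 / (n * ν)
  set T := upperTail (n * ν) x
  -- The constant `198` is `6 * 11 * 3`.
  calc _ = ((2 * κ + ν₂ + 3 * ν ^ 2) * 1.1 ^ (5 * K)) * (11 / ν * M * T * (3 + q)) := by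
        field_simp
    _ ≤ (6 * γ) * (11 / ν * M * T * (3 + q)) := by gcongr
    _ ≤ (6 * γ) * (11 / ν * M * T * (3 * (1 + q))) := by gcongr; linarith
    _ = _ := by ring

/-- Relative Poisson approximation in the range where the relative error is small. -/
lemma abs_measure_sub_upperTail_le_of_small (h : IsOneDependentArray μ Y n K ν ν₂ κ) {C₀ γ : ℝ}
    (hK : (K : ℝ) ≤ C₀) (hC₀ : 1 ≤ C₀) (hγ₁ : Real.exp (1.5 * C₀) * ν ^ 2 ≤ γ)
    (hγ₂ : Real.exp (1.5 * C₀) * ν₂ ≤ γ) (hγ₃ : Real.exp (1.5 * C₀) * κ ≤ γ)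
    (hN : 10 / 11 ≤ n * ν) {x : ℕ} (hx : n * ν < x) (hx' : x ≤ 1.1 * (n * ν))
    (hsmall : 400 * (γ / ν * (1 + (x - n * ν) ^ 2 / (n * ν))) ≤ 1) :
    |μ.real {ω | x ≤ ∑ i ∈ Finset.range (n + 6), Y i ω} - upperTail (n * ν) x| ≤
      198 * (γ / ν * (1 + (x - n * ν) ^ 2 / (n * ν))) * Real.exp 8 * upperTail (n * ν) x := by
  have hN0 : 0 < n * ν := by linarith
  have hν := h.nu_nonneg
  have hγ0 : 0 ≤ γ := le_trans (by positivity) hγ₁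
  have he8 : 2 ≤ Real.exp 8 := by linarith [Real.add_one_le_exp (8 : ℝ)]
  set P : ℕ → ℝ := fun j => μ.real {ω | j ≤ ∑ i ∈ Finset.range (n + 6), Y i ω} with hP
  set T : ℕ → ℝ := upperTail (n * ν) with hT
  have hTpos : ∀ j, 0 < T j := upperTail_pos hN0
  -- The ratio of tails is maximized over `{0, …, x}`. The point `0` has ratio `1`, so the maximum
  -- `M` is at least `1`, and it is an admissible a priori constant.
  obtain ⟨m, hm, hmax⟩ := Finset.exists_max_image (Finset.range (x + 1)) (fun j => P j / T j)
    ⟨0, by simp⟩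
  set M := P m / T m with hMdef
  have hP0 : P 0 = 1 := by simp [hP]
  have hM1 : 1 ≤ M := by
    have := hmax 0 (by simp)
    simpa [hP0, hT] using this
  have htail : ∀ j ≤ x, P j ≤ M * T j := fun j hj => by
    have := hmax j (Finset.mem_range.2 (Nat.lt_succ_of_le hj))
    rwa [div_le_iff₀ (hTpos j)] at this
  have hmx : m ≤ x := Nat.lt_succ_iff.1 (Finset.mem_range.1 hm)
  have hM8 : M ≤ Real.exp 8 := by
    rcases le_or_gt (m : ℝ) (n * ν) with hmN | hmN
    · have h1 := exp_neg_le_upperTail hN hmN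
      have h2 : P m ≤ 1 := measureReal_le_one
      rw [hMdef, div_le_iff₀ (hTpos m)]
      calc P m ≤ Real.exp 8 * Real.exp (-8) := by rw [← Real.exp_add]; simpa using h2
        _ ≤ _ := by gcongr
    -- Self-improvement: the comparison at the maximizing point `m`, with a priori constant `M`,
    -- gives `M - 1 ≤ 198 ε M ≤ M / 2`, hence `M ≤ 2`.
    · have hmx' : (m : ℝ) ≤ x := by exact_mod_cast hmx
      have h1 := h.abs_measure_sub_upperTail_le_coeff hK hC₀ hγ₁ hγ₂ hγ₃ hN0 hmN (hmx'.trans hx')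
        hM1 fun j hj => htail j (hj.trans hmx)
      have h2 : γ / ν * (1 + (m - n * ν) ^ 2 / (n * ν)) ≤
          γ / ν * (1 + (x - n * ν) ^ 2 / (n * ν)) := by
        have : 0 ≤ m - n * ν := by linarith
        gcongr
      have h3 : P m = M * T m := by rw [hMdef, div_mul_cancel₀ _ (hTpos m).ne']
      have h4 : M * T m - T m ≤
          198 * (γ / ν * (1 + (m - n * ν) ^ 2 / (n * ν))) * M * T m := by
        rw [← h3]; exact (le_abs_self _).trans h1
      have h5 : 198 * (γ / ν * (1 + (m - n * ν) ^ 2 / (n * ν))) ≤ 1 / 2 := by linarith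
      have h6 : M * T m - T m ≤ 1 / 2 * M * T m := by
        refine h4.trans ?_
        have := (hTpos m).le
        gcongr
      have h7 : (M - 2) * T m ≤ 0 := by linarith
      have h8 : M - 2 ≤ 0 := by
        by_contra hcon
        exact absurd (mul_pos (not_le.1 hcon) (hTpos m)) (not_lt.2 h7)
      linarith
  refine (h.abs_measure_sub_upperTail_le_coeff hK hC₀ hγ₁ hγ₂ hγ₃ hN0 hx hx' hM1 htail).trans ?_
  have := (hTpos x).le
  gcongr

/-- The Chernoff bound with the moments collected into one coefficient. -/
lemma measure_ge_mul_pow_le_exp (h : IsOneDependentArray μ Y n K ν ν₂ κ) {C₀ γ y : ℝ}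
    (hK : (K : ℝ) ≤ C₀) (hC₀ : 1 ≤ C₀)
    (hγ₂ : Real.exp (1.5 * C₀) * ν₂ ≤ γ) (hγ₃ : Real.exp (1.5 * C₀) * κ ≤ γ)
    (hy0 : 0 ≤ y) (hy : y ≤ 1 / 10) (x : ℕ) :
    μ.real {ω | x ≤ ∑ i ∈ Finset.range (n + 6), Y i ω} * (1 + y) ^ x ≤
      Real.exp (n * ν * y) * (1 + 2 * γ * y ^ 2) ^ n := by
  have hν := h.nu_nonneg
  have hν₂ := h.nu₂_nonneg
  have hκ := h.kappa_nonneg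
  have hγ0 : 0 ≤ γ := le_trans (by positivity) hγ₂
  have hE₁ : (1 + y) ^ K ≤ Real.exp (1.5 * C₀) :=
    pow_le_exp_mul (by linarith) (by linarith) (by linarith)
  have hE₃ : (1 + y) ^ (3 * K) ≤ Real.exp (1.5 * C₀) :=
    pow_le_exp_mul (by linarith) (by linarith) (by push_cast; linarith)
  refine (h.measure_ge_mul_pow_le hy0 x).trans ?_
  have h1 : ν₂ / 2 * y ^ 2 * (1 + y) ^ K ≤ γ / 2 * y ^ 2 := by
    calc _ ≤ ν₂ / 2 * y ^ 2 * Real.exp (1.5 * C₀) := by gcongr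
      _ = (Real.exp (1.5 * C₀) * ν₂) / 2 * y ^ 2 := by ring
      _ ≤ _ := by gcongr
  have h2 : κ * y ^ 2 * (1 + y) ^ (3 * K) ≤ γ * y ^ 2 := by
    calc _ ≤ κ * y ^ 2 * Real.exp (1.5 * C₀) := by gcongr
      _ = (Real.exp (1.5 * C₀) * κ) * y ^ 2 := by ring
      _ ≤ _ := by gcongr
  have h3 : Real.exp (n * ν * y) = Real.exp (ν * y) ^ n := by
    rw [← Real.exp_nat_mul]; ring_nf
  rw [h3, ← mul_pow]
  gcongr
  have h4 := Real.add_one_le_exp (ν * y)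
  have h5 : 0 ≤ γ * y ^ 2 := by positivity
  have h6 : 0 ≤ ν * y := by positivity
  calc _ ≤ (ν * y + 1) * (1 + 2 * γ * y ^ 2) := by nlinarith [mul_nonneg h6 h5]
    _ ≤ _ := by gcongr

end IsOneDependentArray

/-! ### Change of the Poisson parameter from `N` to `N (1 - u)`. -/

section PoissonShift

variable {N ν y u : ℝ}

/-- Comparison of Poisson tails with parameters `N` and `N (1 - u)`. -/
lemma upperTail_sub_upperTail_shift_le (hN : 0 < N) (hν0 : 0 ≤ ν) (hy0 : 0 < y) (hy : y ≤ 1 / 10)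
    (hu0 : 0 ≤ u) (hu : u ≤ 1.01 * ν * y) (hu' : u ≤ 1 / 1000) {x : ℕ} (hx : (x : ℝ) = N * (1 + y)) :
    upperTail N x - upperTail (N * (1 - u)) x ≤
      16 * ν * (1 + (x - N) ^ 2 / N) * upperTail N x := by
  have hs : 0 < √N := Real.sqrt_pos.2 hN
  have hss : √N * √N = N := Real.mul_self_sqrt hN.le
  have hxN : N ≤ x := by rw [hx]; nlinarith
  have hN' : 0 < N * (1 - u) := by apply mul_pos hN; linarith
  have h1 := upperTail_sub_le (L := N) hN' (by nlinarith) hxN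
  have h2 := poissonWeight_mul_sqrt_le hN hxN
  have hT := upperTail_nonneg hN x
  have hp := (poissonWeight_pos hN x).le
  set t := y * √N with ht
  have ht0 : 0 ≤ t := by positivity
  have e1 : (x - N) / √N = t := by
    rw [hx, ht, div_eq_iff hs.ne']; linear_combination (-y) * hss
  have e2 : (x - N) ^ 2 / N = t ^ 2 := by
    rw [hx, ht, div_eq_iff hN.ne', mul_pow, sq (√N), hss]; ring
  rw [e1] at h2
  rw [e2]
  have h3 : x / (N * (1 - u)) ≤ 1.2 := by
    rw [div_le_iff₀ hN', hx]; nlinarith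
  have he2 : Real.exp 2 ≤ 8 := by
    have : Real.exp 2 = Real.exp 1 * Real.exp 1 := by rw [← Real.exp_add]; norm_num
    rw [this]
    nlinarith [Real.exp_one_lt_d9, Real.exp_pos 1]
  have h4 : poissonWeight N x * N ≤ 8 * (1 + t) * upperTail N x * √N := by
    calc _ = poissonWeight N x * √N * √N := by rw [mul_assoc, hss]
      _ ≤ Real.exp 2 * (1 + t) * upperTail N x * √N := by gcongr
      _ ≤ _ := by gcongr
  calc _ ≤ _ := h1
    _ = x / (N * (1 - u)) * (poissonWeight N x * N) * u := by ring
    -- The change `N u` of the parameter meets a weight of order `(1 + t) / √N` times the tail, so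
    -- the relative change is of order `ν t (1 + t)`, with `t` the standardized deviation.
    _ ≤ 1.2 * (8 * (1 + t) * upperTail N x * √N) * (1.01 * ν * y) := by gcongr
    _ = 9.696 * ν * (t * (1 + t)) * upperTail N x := by rw [ht]; ring
    _ ≤ _ := by
      gcongr ?_ * _
      have : t * (1 + t) ≤ 3 / 2 * (1 + t ^ 2) := by nlinarith [sq_nonneg (t - 1)]
      have h5 : ν * (t * (1 + t)) ≤ ν * (3 / 2 * (1 + t ^ 2)) := by gcongr
      have h6 : 0 ≤ ν * (1 + t ^ 2) := by positivity
      nlinarith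

/-- Chernoff lower bound for a Poisson tail with parameter `N (1 - u)`. -/
lemma exp_le_upperTail_shift (hN : 0 < N) (hν0 : 0 ≤ ν) (hν : ν ≤ 1 / 100) (hy0 : 0 < y)
    (hy : y ≤ 1 / 10) (hu0 : 0 ≤ u) (hu : u ≤ 1.01 * ν * y) (hu' : u ≤ 1 / 1000) {x : ℕ}
    (hx : (x : ℝ) = N * (1 + y)) :
    Real.exp (N * y) ≤ 2 * Real.exp 4 * (1 + y * √N) * Real.exp (2 * ν * N * y ^ 2) *
      (upperTail (N * (1 - u)) x * (1 + y) ^ x) := by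
  have hs : 0 < √N := Real.sqrt_pos.2 hN
  have h1u : 0 < 1 - u := by linarith
  have hN' : 0 < N * (1 - u) := mul_pos hN h1u
  have hxpos : (0 : ℝ) < x := by rw [hx]; positivity
  have hT := upperTail_nonneg hN' x
  have hch := chernoff_le_upperTail hN' (x := x) (by rw [hx]; nlinarith) (by rw [hx]; nlinarith)
  have ht : 1 + (x - N * (1 - u)) / √(N * (1 - u)) ≤ 2 * (1 + y * √N) := by
    have hs' : 0.9 * √N ≤ √(N * (1 - u)) := by
      apply Real.le_sqrt_of_sq_le
      rw [mul_pow, Real.sq_sqrt hN.le]; nlinarith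
    have : (x - N * (1 - u)) / √(N * (1 - u)) ≤ 2 * (y * √N) := by
      rw [div_le_iff₀ (by positivity)]
      have h2 : x - N * (1 - u) ≤ 1.8 * (y * N) := by
        have h0 : ν * y ≤ 1 / 100 * y := by gcongr
        have h1 : u ≤ 0.8 * y := by linarith
        have h2 : N * u ≤ N * (0.8 * y) := by gcongr
        rw [hx]; linarith
      have h3 : 2 * (y * √N) * (0.9 * √N) = 1.8 * (y * N) := by
        linear_combination 1.8 * y * Real.mul_self_sqrt hN.le
      calc _ ≤ _ := h2
        _ = _ := h3.symm
        _ ≤ _ := by gcongr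
    linarith
  -- To first order in `u`, `(1 - u)^x` is `e^{-x u}`. The mismatch with `e^{-N u}` is `N u (y + u)
  -- / (1 - u)`, of order `ν N y²`, and is later absorbed in `(1 + 5 γ y²)^n`.
  have hpow : Real.exp (-(N * u)) ≤ (1 - u) ^ x * Real.exp (2 * ν * N * y ^ 2) := by
    have h2 : Real.exp (-(u / (1 - u))) ≤ 1 - u := by
      have h3 := Real.add_one_le_exp (u / (1 - u))
      have h4 : u / (1 - u) + 1 = (1 - u)⁻¹ := by field_simp; ring
      rw [h4] at h3
      rw [Real.exp_neg]
      have := inv_anti₀ (by positivity) h3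
      rwa [inv_inv] at this
    have h5 : Real.exp (x * -(u / (1 - u))) ≤ (1 - u) ^ x := by
      rw [Real.exp_nat_mul]; gcongr
    refine le_trans ?_ (mul_le_mul_of_nonneg_right h5 (Real.exp_pos _).le)
    rw [← Real.exp_add, Real.exp_le_exp]
    have h6 : x * (u / (1 - u)) - N * u = N * (u * (y + u) / (1 - u)) := by
      rw [hx]; field_simp; ring
    have h7 : u * (y + u) / (1 - u) ≤ 2 * ν * y ^ 2 := by
      rw [div_le_iff₀ h1u]
      have h8 : u * (y + u) ≤ (1.01 * ν * y) * (1.1 * y) := by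
        gcongr; nlinarith
      have h9 : 0 ≤ ν * y ^ 2 := by positivity
      nlinarith
    have h10 : N * (u * (y + u) / (1 - u)) ≤ N * (2 * ν * y ^ 2) := by gcongr
    linarith
  -- Since `x = N (1 + y)`, the factors `(N / x)^x` and `(1 + y)^x` cancel: the Chernoff tilt is the
  -- optimal one for the Poisson law.
  have hid : Real.exp (N * y) =
      (N * (1 - u) / x) ^ x * Real.exp (x - N * (1 - u)) * ((1 + y) ^ x / (1 - u) ^ x) *
        Real.exp (-(N * u)) := by
    have h2 : (N * (1 - u) / x) ^ x * ((1 + y) ^ x / (1 - u) ^ x) = 1 := by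
      rw [← div_pow, ← mul_pow, hx]
      have : N * (1 - u) / (N * (1 + y)) * ((1 + y) / (1 - u)) = 1 := by field_simp
      rw [this, one_pow]
    calc Real.exp (N * y) = Real.exp (x - N * (1 - u)) * Real.exp (-(N * u)) := by
          rw [← Real.exp_add, hx]; congr 1; ring
      _ = _ := by linear_combination (-(Real.exp (x - N * (1 - u)) * Real.exp (-(N * u)))) * h2
  rw [hid]
  calc _ ≤ (Real.exp 4 * (2 * (1 + y * √N)) * upperTail (N * (1 - u)) x) *
        ((1 + y) ^ x / (1 - u) ^ x) * ((1 - u) ^ x * Real.exp (2 * ν * N * y ^ 2)) := by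
        have h1 := hch.trans (mul_le_mul_of_nonneg_right
          (mul_le_mul_of_nonneg_left ht (Real.exp_pos 4).le) hT)
        have h2 : 0 ≤ (1 + y) ^ x / (1 - u) ^ x := by positivity
        exact mul_le_mul (mul_le_mul_of_nonneg_right h1 h2) hpow (Real.exp_pos _).le (by positivity)
    _ = _ := by field_simp

end PoissonShift

/-! ### The series `Λ*`. -/

section Lambda

/-- The series is one in powers of `u`, dominated by a geometric series with first term `u² / 2` and
ratio `u ≤ 1 / 2`. -/
lemma LambdaStar_bounds {ν y u : ℝ} (n : ℕ) (hu : u = ν / (1 - ν) * y) (hu0 : 0 ≤ u)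
    (hu' : u ≤ 1 / 2) : 0 ≤ LambdaStar n ν y ∧ LambdaStar n ν y ≤ n * u ^ 2 := by
  have hterm : ∀ j : ℕ, (1 / ((j + 2 : ℕ) : ℝ)) * (ν / (1 - ν)) ^ (j + 2) * y ^ (j + 2) =
      1 / ((j + 2 : ℕ) : ℝ) * u ^ (j + 2) := fun j => by rw [hu, mul_pow, mul_assoc]
  have hsum : Summable fun j : ℕ => u ^ 2 / 2 * u ^ j :=
    (summable_geometric_of_lt_one hu0 (by linarith)).mul_left _
  have hle : ∀ j : ℕ, 1 / ((j + 2 : ℕ) : ℝ) * u ^ (j + 2) ≤ u ^ 2 / 2 * u ^ j := fun j => by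
    have h1 : 1 / ((j + 2 : ℕ) : ℝ) ≤ 1 / 2 := by
      gcongr; push_cast; linarith [(Nat.cast_nonneg j : (0 : ℝ) ≤ j)]
    calc _ ≤ 1 / 2 * u ^ (j + 2) := by gcongr
      _ = _ := by ring
  have hnn : ∀ j : ℕ, 0 ≤ 1 / ((j + 2 : ℕ) : ℝ) * u ^ (j + 2) := fun j => by positivity
  unfold LambdaStar
  simp_rw [hterm]
  refine ⟨mul_nonneg (Nat.cast_nonneg n) (tsum_nonneg hnn), ?_⟩
  gcongr
  refine ((hsum.of_nonneg_of_le hnn hle).tsum_le_tsum hle hsum).trans ?_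
  rw [tsum_mul_left, tsum_geometric_of_lt_one hu0 (by linarith)]
  have : (1 - u)⁻¹ ≤ 2 := by
    rw [inv_le_comm₀ (by linarith) (by norm_num)]; linarith
  nlinarith [sq_nonneg u]

end Lambda

/-! ### Numerical inequalities. -/

section RealBounds

lemma four_le_exp_of_one_le {C₀ : ℝ} (hC₀ : 1 ≤ C₀) : 4 ≤ Real.exp (1.5 * C₀) := by
  have h2 : Real.exp (3 / 2) ≤ Real.exp (1.5 * C₀) := Real.exp_le_exp.2 (by linarith)
  have h3 : Real.exp (3 / 2) = Real.exp (1 / 2) ^ 3 := by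
    rw [← Real.exp_nat_mul]; norm_num
  have h4 : 1.64 ≤ Real.exp (1 / 2) := by
    have h5 : Real.exp 1 = Real.exp (1 / 2) ^ 2 := by rw [← Real.exp_nat_mul]; norm_num
    have := Real.exp_one_gt_d9
    nlinarith [Real.exp_pos (1 / 2)]
  have h6 : (1.64 : ℝ) ^ 3 ≤ Real.exp (1 / 2) ^ 3 := by gcongr
  norm_num at h6 ⊢
  linarith

lemma exp_le_one_add_two_mul {w : ℝ} (hw : 0 ≤ w) (hw' : w ≤ 1) : Real.exp w ≤ 1 + 2 * w := by
  have := Real.abs_exp_sub_one_le (x := w) (by rwa [abs_of_nonneg hw])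
  rw [abs_of_nonneg hw] at this
  linarith [le_abs_self (Real.exp w - 1)]

lemma exp_mul_one_add_le {w : ℝ} (hw : 0 ≤ w) (hw' : w ≤ 1 / 100) :
    Real.exp w * (1 + 2 * w) ≤ 1 + 5 * w := by
  calc _ ≤ (1 + 2 * w) * (1 + 2 * w) := by
        gcongr; exact exp_le_one_add_two_mul hw (by linarith)
    _ ≤ _ := by nlinarith

/-- For small `ε` the correcting factors of the expansion differ from `1` by `O(ε)`, so a comparison
of the ratio with `1` suffices. -/
lemma exp_mul_one_add_pow_le {Λ w ε : ℝ} {n : ℕ} (hw : 0 ≤ w) (hΛ : Λ ≤ ε)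
    (hn : n * w ≤ ε) (hε0 : 0 ≤ ε) (hε : 400 * ε ≤ 1) :
    Real.exp Λ * (1 + 5 * w) ^ n ≤ 1 + 12 * ε := by
  have hB : (1 + 5 * w) ^ n ≤ Real.exp (5 * ε) := by
    calc _ ≤ Real.exp (5 * w) ^ n := by
          gcongr
          linarith [Real.add_one_le_exp (5 * w)]
      _ = Real.exp (5 * (n * w)) := by rw [← Real.exp_nat_mul]; ring_nf
      _ ≤ _ := by gcongr
  calc _ ≤ Real.exp ε * Real.exp (5 * ε) := by gcongr
    _ = Real.exp (6 * ε) := by rw [← Real.exp_add]; ring_nf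
    _ ≤ 1 + 2 * (6 * ε) := exp_le_one_add_two_mul (by positivity) (by linarith)
    _ = _ := by ring

/-- `P` is close to the tail `T` with parameter `N`, `T` to the tail `T'` with the shifted
parameter, and the main term `A` to `1`; the triangle inequality combines the three errors. -/
lemma abs_div_sub_le_of_close {P T T' A ε c : ℝ} (hT' : 0 < T') (hc : 9 ≤ c) (hε0 : 0 ≤ ε)
    (hε : 400 * ε ≤ 1) (hT'T : T' ≤ T) (hPT : |P - T| ≤ 198 * ε * c * T)
    (hTT' : T - T' ≤ 4 * ε * T) (hA1 : 1 ≤ A) (hA : A ≤ 1 + 12 * ε) :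
    |P / T' - A| ≤ 600 * c * ε := by
  have hT : 0 < T := hT'.trans_le hT'T
  have hεT : ε * T ≤ 1 / 400 * T := by gcongr; linarith
  have h4 : T ≤ 2 * T' := by linarith
  have hεc : 9 * ε ≤ c * ε := by gcongr
  have h5 : |P - T'| ≤ 500 * c * ε * T' := by
    have h6 : |P - T'| ≤ |P - T| + (T - T') := by
      have := abs_sub_le P T T'
      rwa [abs_of_nonneg (show 0 ≤ T - T' by linarith)] at this
    have h7 : 4 * ε * T ≤ 2 * (c * ε) * T := by gcongr ?_ * _; linarith
    have h8 : 200 * (c * ε) * T ≤ 200 * (c * ε) * (2 * T') := by gcongr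
    have h9 : 0 ≤ c * ε * T' := by positivity
    linarith
  have h8 : |P / T' - 1| ≤ 500 * c * ε := by
    have : P / T' - 1 = (P - T') / T' := by field_simp
    rw [this, abs_div, abs_of_pos hT', div_le_iff₀ hT']
    exact h5
  have h10 := abs_sub_le (P / T') 1 A
  rw [abs_sub_comm 1 A, abs_of_nonneg (show 0 ≤ A - 1 by linarith)] at h10
  linarith

lemma exists_theta_of_abs_sub_le {R A E : ℝ} (hA : 0 < A) (hE : 0 < E) (h : |R - A| ≤ A * E) :
    ∃ θ : ℝ, |θ| ≤ 1 ∧ R = A * (1 + θ * E) := by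
  refine ⟨(R - A) / (A * E), ?_, ?_⟩
  · rw [abs_div, abs_of_pos (mul_pos hA hE)]
    exact (div_le_one (mul_pos hA hE)).2 h
  · field_simp
    ring

end RealBounds

/-! ### Assembly of the two regimes. -/

namespace IsOneDependentArray

variable {Ω : Type*} [mΩ : MeasurableSpace Ω] {μ : Measure Ω} [IsProbabilityMeasure μ]
  {Y : ℕ → Ω → ℕ} {n K : ℕ} {ν ν₂ κ : ℝ}

/-- A bound for the ratio of tails that is crude by a factor of the order of the standardized
deviation. -/
lemma measure_div_upperTail_le (h : IsOneDependentArray μ Y n K ν ν₂ κ) {C₀ γ y u : ℝ}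
    (hK : (K : ℝ) ≤ C₀) (hC₀ : 1 ≤ C₀) (hγ₁ : 4 * ν ^ 2 ≤ γ)
    (hγ₂ : Real.exp (1.5 * C₀) * ν₂ ≤ γ) (hγ₃ : Real.exp (1.5 * C₀) * κ ≤ γ) (hγ : γ ≤ 1)
    (hN : 0 < n * ν) (hν : ν ≤ 1 / 100) (hy0 : 0 < y) (hy : y ≤ 1 / 10) (hu0 : 0 ≤ u)
    (hu : u ≤ 1.01 * ν * y) (hu' : u ≤ 1 / 1000) {x : ℕ} (hx : (x : ℝ) = n * ν * (1 + y)) :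
    μ.real {ω | x ≤ ∑ i ∈ Finset.range (n + 6), Y i ω} / upperTail (n * ν * (1 - u)) x ≤
      (1 + 5 * γ * y ^ 2) ^ n * (2 * Real.exp 4 * (1 + y * √(n * ν))) := by
  have hν0 := h.nu_nonneg
  have hc := h.measure_ge_mul_pow_le_exp hK hC₀ hγ₂ hγ₃ hy0.le hy x
  have hl := exp_le_upperTail_shift hN hν0 hν hy0 hy hu0 hu hu' hx
  have hN' : 0 < n * ν * (1 - u) := mul_pos hN (by linarith)
  have hTpos := upperTail_pos hN' x
  have hγ0 : 0 ≤ γ := le_trans (by positivity) hγ₁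
  have hpw : 0 < (1 + y) ^ x := by positivity
  set T := upperTail (n * ν * (1 - u)) x
  set P := μ.real {ω | x ≤ ∑ i ∈ Finset.range (n + 6), Y i ω}
  have h1 : Real.exp (2 * ν * (n * ν) * y ^ 2) * (1 + 2 * γ * y ^ 2) ^ n ≤
      (1 + 5 * γ * y ^ 2) ^ n := by
    have h2 : Real.exp (2 * ν * (n * ν) * y ^ 2) ≤ Real.exp (γ * y ^ 2) ^ n := by
      rw [← Real.exp_nat_mul, Real.exp_le_exp]
      have : 2 * ν ^ 2 ≤ γ := by linarith [sq_nonneg ν]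
      calc _ = n * ((2 * ν ^ 2) * y ^ 2) := by ring
        _ ≤ _ := by gcongr
    have h3 : y ^ 2 ≤ (1 / 10) ^ 2 := by gcongr
    have h4 : γ * y ^ 2 ≤ 1 * (1 / 10) ^ 2 := by gcongr
    calc _ ≤ Real.exp (γ * y ^ 2) ^ n * (1 + 2 * γ * y ^ 2) ^ n := by gcongr
      _ = (Real.exp (γ * y ^ 2) * (1 + 2 * (γ * y ^ 2))) ^ n := by
        rw [mul_pow, ← mul_assoc 2]
      _ ≤ (1 + 5 * (γ * y ^ 2)) ^ n := by
        gcongr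
        exact exp_mul_one_add_le (by positivity) (by linarith)
      _ = _ := by rw [mul_assoc 5]
  rw [div_le_iff₀ hTpos]
  refine le_of_mul_le_mul_right ?_ hpw
  calc P * (1 + y) ^ x ≤ _ := hc
    _ ≤ (2 * Real.exp 4 * (1 + y * √(n * ν)) * Real.exp (2 * ν * (n * ν) * y ^ 2) *
        (T * (1 + y) ^ x)) * (1 + 2 * γ * y ^ 2) ^ n := by gcongr
    _ = (Real.exp (2 * ν * (n * ν) * y ^ 2) * (1 + 2 * γ * y ^ 2) ^ n) *
        (2 * Real.exp 4 * (1 + y * √(n * ν))) * T * (1 + y) ^ x := by ring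
    _ ≤ _ := by gcongr

/-- The large deviation expansion for 1-dependent arrays. -/
theorem exists_tail_expansion (h : IsOneDependentArray μ Y n K ν ν₂ κ) {C₀ γ y : ℝ}
    (hK : (K : ℝ) ≤ C₀) (hC₀ : 1 ≤ C₀) (hγ₁ : Real.exp (1.5 * C₀) * ν ^ 2 ≤ γ)
    (hγ₂ : Real.exp (1.5 * C₀) * ν₂ ≤ γ) (hγ₃ : Real.exp (1.5 * C₀) * κ ≤ γ)
    (hγ : γ ≤ 1) (hν0 : 0 < ν) (hν : ν ≤ 1 / 1000) (hn : 1 ≤ n) {x : ℕ}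
    (hx : n * ν < x) (hy : y = relDev n x ν) (hy' : |y| ≤ 1 / 10) :
    ∃ θ : ℝ, |θ| ≤ 1 ∧
      μ.real {ω | x ≤ ∑ i ∈ Finset.range (n + 6), Y i ω} / poissonTail (n * lambdaStar ν y) x =
        Real.exp (LambdaStar n ν y) * (1 + 5 * γ * y ^ 2) ^ n *
          (1 + 10000 * Real.exp 8 * θ * γ * √(n * ν) * (ν⁻¹ + n * y ^ 2)) := by
  have hn0 : (0 : ℝ) < n := by exact_mod_cast hn
  have hN0 : 0 < n * ν := by positivity
  have hyN : (x : ℝ) = n * ν * (1 + y) := by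
    rw [hy, relDev]; field_simp; ring
  have hy0 : 0 < y := by
    rw [hy, relDev]; exact div_pos (by linarith) hN0
  have hy1 : y ≤ 1 / 10 := (le_abs_self y).trans hy'
  have hx1 : (1 : ℝ) ≤ x := by
    have : 0 < x := by exact_mod_cast hN0.trans hx
    exact_mod_cast this
  have hNy : n * ν * y ≤ n * ν * (1 / 10) := by gcongr
  have hx' : (x : ℝ) ≤ 1.1 * (n * ν) := by rw [hyN]; linarith
  -- As `x` is a positive integer and `x ≤ 1.1 N`, the mean `N` cannot be small.
  have hN : 10 / 11 ≤ n * ν := by linarith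
  have hs : 0 < √(n * ν) := Real.sqrt_pos.2 hN0
  have hs9 : 9 / 10 ≤ √(n * ν) := by apply Real.le_sqrt_of_sq_le; linarith
  have hγ4 : 4 * ν ^ 2 ≤ γ :=
    le_trans (by gcongr; exact four_le_exp_of_one_le hC₀) hγ₁
  have hγ0 : 0 < γ := lt_of_lt_of_le (by positivity) hγ4
  obtain ⟨u, hu⟩ : ∃ u, u = ν / (1 - ν) * y := ⟨_, rfl⟩
  have hν1 : 0 < 1 - ν := by linarith
  have hu0 : 0 ≤ u := by rw [hu]; positivity
  have huν : u ≤ 1.01 * ν * y := by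
    rw [hu]; gcongr
    rw [div_le_iff₀ hν1]; nlinarith
  have hu1 : u ≤ 1 / 1000 := by
    have : ν * y ≤ 1 / 1000 * (1 / 10) := by gcongr
    linarith
  have hlam : n * lambdaStar ν y = n * ν * (1 - u) := by rw [lambdaStar, hu, ← mul_assoc]
  have hN' : 0 < n * ν * (1 - u) := mul_pos hN0 (by linarith)
  rw [hlam, poissonTail_eq_upperTail hN']
  have hTpos' := upperTail_pos hN' x
  have hq : (x - n * ν) ^ 2 / (n * ν) = n * ν * y ^ 2 := by
    rw [hyN]; field_simp; ring
  obtain ⟨ε, hε⟩ : ∃ ε, ε = γ / ν * (1 + (x - n * ν) ^ 2 / (n * ν)) := ⟨_, rfl⟩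
  have hε0 : 0 < ε := by rw [hε]; positivity
  have hγε : n * (γ * y ^ 2) ≤ ε := by
    have h1 : ε = γ / ν + n * (γ * y ^ 2) := by rw [hε, hq]; field_simp
    have : 0 ≤ γ / ν := by positivity
    linarith
  -- The error term of the statement is `√N` times the natural Stein-Chen error `ε`.
  have hEε : γ * √(n * ν) * (ν⁻¹ + n * y ^ 2) = √(n * ν) * ε := by
    rw [hε, hq]; field_simp
  have hΛ := LambdaStar_bounds n hu hu0 (by linarith)
  have hγy : 0 ≤ γ * y ^ 2 := by positivity
  have hB1 : 1 ≤ (1 + 5 * γ * y ^ 2) ^ n := one_le_pow₀ (by linarith)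
  have hBA := le_mul_of_one_le_left (by positivity : 0 ≤ (1 + 5 * γ * y ^ 2) ^ n)
    (Real.one_le_exp hΛ.1)
  have he8 : 9 ≤ Real.exp 8 := by linarith [Real.add_one_le_exp (8 : ℝ)]
  have hE0 : 0 < 10000 * Real.exp 8 * (√(n * ν) * ε) := by positivity
  suffices hmain : |μ.real {ω | x ≤ ∑ i ∈ Finset.range (n + 6), Y i ω} /
      upperTail (n * ν * (1 - u)) x - Real.exp (LambdaStar n ν y) * (1 + 5 * γ * y ^ 2) ^ n| ≤
      Real.exp (LambdaStar n ν y) * (1 + 5 * γ * y ^ 2) ^ n *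
        (10000 * Real.exp 8 * (√(n * ν) * ε)) by
    obtain ⟨θ, hθ, hR⟩ := exists_theta_of_abs_sub_le (by linarith) hE0 hmain
    refine ⟨θ, hθ, hR.trans ?_⟩
    rw [← hEε]; ring
  rcases le_or_gt (400 * ε) 1 with hcase | hcase
  · have h1 := h.abs_measure_sub_upperTail_le_of_small hK hC₀ hγ₁ hγ₂ hγ₃ hN hx hx'
      (by rw [← hε]; exact hcase)
    rw [← hε] at h1
    have h2 : upperTail (n * ν * (1 - u)) x ≤ upperTail (n * ν) x :=
      upperTail_mono hN' (mul_le_of_le_one_right hN0.le (by linarith)) x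
    have h3 : upperTail (n * ν) x - upperTail (n * ν * (1 - u)) x ≤
        4 * ε * upperTail (n * ν) x := by
      refine (upperTail_sub_upperTail_shift_le hN0 hν0.le hy0 hy1 hu0 huν hu1 hyN).trans ?_
      refine mul_le_mul_of_nonneg_right ?_ (upperTail_nonneg hN0 x)
      have : 4 * ν ≤ γ / ν := by rw [le_div_iff₀ hν0]; linarith
      calc 16 * ν * (1 + (x - n * ν) ^ 2 / (n * ν)) =
            4 * ((4 * ν) * (1 + (x - n * ν) ^ 2 / (n * ν))) := by ring
        _ ≤ 4 * (γ / ν * (1 + (x - n * ν) ^ 2 / (n * ν))) := by gcongr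
        _ = _ := by rw [hε]
    have hΛ' : LambdaStar n ν y ≤ ε := by
      have h10 : u ^ 2 ≤ γ * y ^ 2 := by
        have h11 : u ^ 2 ≤ (1.01 * ν * y) ^ 2 := by gcongr
        have h12 : 4 * ν ^ 2 * y ^ 2 ≤ γ * y ^ 2 := by gcongr
        linarith [mul_nonneg (sq_nonneg ν) (sq_nonneg y)]
      refine hΛ.2.trans (le_trans ?_ hγε)
      gcongr
    have hA := exp_mul_one_add_pow_le hγy hΛ' hγε hε0.le hcase
    rw [← mul_assoc 5] at hA
    refine (abs_div_sub_le_of_close hTpos' he8 hε0.le hcase h2 h1 h3 (hB1.trans hBA) hA).trans ?_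
    have hc : 600 * Real.exp 8 * ε ≤ 10000 * Real.exp 8 * (√(n * ν) * ε) := by
      have h13 : 9 / 10 * ε ≤ √(n * ν) * ε := by gcongr
      have h14 : Real.exp 8 * (9 / 10 * ε) ≤ Real.exp 8 * (√(n * ν) * ε) := by gcongr
      have : 0 ≤ Real.exp 8 * ε := by positivity
      linarith
    exact hc.trans (le_mul_of_one_le_left hE0.le (hB1.trans hBA))
  -- Here the allowed relative error exceeds `1`, so nonnegativity of the ratio settles the lower
  -- bound, and the crude factor `1 + y √N` is affordable in the upper bound.
  · have hEbig : 200 * √(n * ν) ≤ 10000 * Real.exp 8 * (√(n * ν) * ε) := by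
      calc 200 * √(n * ν) ≤ 10000 * 9 * (√(n * ν) * (1 / 400)) := by linarith
        _ ≤ _ := by gcongr; linarith
    have hR := h.measure_div_upperTail_le hK hC₀ hγ4 hγ₂ hγ₃ hγ hN0 (by linarith) hy0 hy1 hu0 huν
      hu1 hyN
    have he4 : Real.exp 4 ≤ 60 := by
      have h1 : Real.exp 4 = Real.exp 1 ^ 4 := by rw [← Real.exp_nat_mul]; norm_num
      have h2 : Real.exp 1 ≤ 2.75 := by linarith [Real.exp_one_lt_d9]
      calc Real.exp 4 = Real.exp 1 ^ 4 := h1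
        _ ≤ 2.75 ^ 4 := by gcongr
        _ ≤ 60 := by norm_num
    have hcrude : 2 * Real.exp 4 * (1 + y * √(n * ν)) ≤ 10000 * Real.exp 8 * (√(n * ν) * ε) := by
      calc _ ≤ 2 * 60 * (10 / 9 * √(n * ν) + 1 / 10 * √(n * ν)) := by
            gcongr; linarith
        _ ≤ _ := by linarith
    have hRE := hR.trans (mul_le_mul hBA hcrude (by positivity) (by positivity))
    have hR0 : 0 ≤ μ.real {ω | x ≤ ∑ i ∈ Finset.range (n + 6), Y i ω} /
        upperTail (n * ν * (1 - u)) x := div_nonneg measureReal_nonneg hTpos'.le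
    have hE1 := le_mul_of_one_le_right (by positivity :
      0 ≤ Real.exp (LambdaStar n ν y) * (1 + 5 * γ * y ^ 2) ^ n)
      (show 1 ≤ 10000 * Real.exp 8 * (√(n * ν) * ε) by linarith)
    rw [abs_le]
    constructor <;> linarith

end IsOneDependentArray

/-! ### Reduction to a padded array. -/

/-- The variables `X 1, …, X n`, truncated at `K`, with index shifted by `2` and padded by zeros. -/
def paddedTruncation {Ω : Type*} (X : ℕ → Ω → ℕ) (n K : ℕ) (j : ℕ) (ω : Ω) : ℕ :=
  if 3 ≤ j ∧ j < n + 3 then min (X (j - 2) ω) K else 0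

section Transfer

variable {Ω : Type*} {X : ℕ → Ω → ℕ} {n K : ℕ}

lemma paddedTruncation_of_not {j : ℕ} (hj : ¬(3 ≤ j ∧ j < n + 3)) (ω : Ω) :
    paddedTruncation X n K j ω = 0 := by
  simp only [paddedTruncation, if_neg hj]

lemma comap_paddedTruncation_of_not {j : ℕ} (hj : ¬(3 ≤ j ∧ j < n + 3)) :
    MeasurableSpace.comap (paddedTruncation X n K j) inferInstance = ⊥ := by
  have : paddedTruncation X n K j = fun _ => 0 := funext (paddedTruncation_of_not hj)
  rw [this, MeasurableSpace.comap_const]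

lemma comap_paddedTruncation_le (j : ℕ) :
    MeasurableSpace.comap (paddedTruncation X n K j) inferInstance ≤
      MeasurableSpace.comap (X (j - 2)) inferInstance := by
  by_cases hj : 3 ≤ j ∧ j < n + 3
  · have : paddedTruncation X n K j = (fun m => min m K) ∘ X (j - 2) := by
      funext ω; simp only [paddedTruncation, if_pos hj, Function.comp]
    rw [this, ← MeasurableSpace.comap_comp]
    exact MeasurableSpace.comap_mono (measurable_of_countable fun m : ℕ => min m K).comap_le
  · rw [comap_paddedTruncation_of_not hj]; exact bot_le

lemma sigmaOf_paddedTruncation_le {I J : Set ℕ}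
    (h : ∀ j ∈ I, 3 ≤ j → j < n + 3 → j - 2 ∈ J) :
    sigmaOf (paddedTruncation X n K) I ≤
      ⨆ i ∈ J, MeasurableSpace.comap (X i) inferInstance := by
  refine iSup₂_le fun j hj => ?_
  by_cases hj' : 3 ≤ j ∧ j < n + 3
  · exact (comap_paddedTruncation_le j).trans
      (le_iSup₂ (f := fun i (_ : i ∈ J) => MeasurableSpace.comap (X i) inferInstance) (j - 2)
        (h j hj hj'.1 hj'.2))
  · rw [comap_paddedTruncation_of_not hj']; exact bot_le

lemma sigmaOf_paddedTruncation_eq_bot {I : Set ℕ} (h : ∀ j ∈ I, ¬(3 ≤ j ∧ j < n + 3)) :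
    sigmaOf (paddedTruncation X n K) I = ⊥ :=
  le_bot_iff.1 (iSup₂_le fun j hj => (comap_paddedTruncation_of_not (h j hj)).le)

variable [MeasurableSpace Ω] {μ : Measure Ω} [IsProbabilityMeasure μ]

/-- After the index shift, the past of `s` involves `X` up to index `s - 3` and the future `X` from
`s - 1` on, a gap of `2`. For `s ≤ 3` or `s ≥ n + 2` one of the two sides contains only padding and
is trivial. -/
lemma indep_sigmaOf_paddedTruncation (h : IsMDependent 1 n X μ) (s : ℕ) :
    Indep (sigmaOf (paddedTruncation X n K) (Set.Iio s))
      (sigmaOf (paddedTruncation X n K) (Set.Ioi s)) μ := by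
  by_cases h1 : s ≤ 3
  · rw [sigmaOf_paddedTruncation_eq_bot (I := Set.Iio s)
      fun j hj => by have := Set.mem_Iio.1 hj; omega]
    exact indep_bot_left _
  by_cases h2 : n + 2 ≤ s
  · rw [sigmaOf_paddedTruncation_eq_bot (I := Set.Ioi s)
      fun j hj => by have := Set.mem_Ioi.1 hj; omega]
    exact indep_bot_right _
  refine indep_of_indep_of_le_right (indep_of_indep_of_le_left
    (h (s - 3) (s - 1) (by omega) (by omega) (by omega)) ?_) ?_
  · exact sigmaOf_paddedTruncation_le fun j hj h3 h4 => by
      have := Set.mem_Iio.1 hj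
      exact ⟨by omega, by omega⟩
  · exact sigmaOf_paddedTruncation_le fun j hj h3 h4 => by
      have := Set.mem_Ioi.1 hj
      exact ⟨by omega, by omega⟩

lemma paddedTruncation_ae_eq {C₀ : ℝ} (hid : ∀ k ∈ Finset.Icc 1 n, IdentDistrib (X k) (X 1) μ μ)
    (hC : ∀ᵐ ω ∂μ, (X 1 ω : ℝ) ≤ C₀) {k : ℕ} (hk : k < n) :
    ∀ᵐ ω ∂μ, paddedTruncation X n ⌊C₀⌋₊ (k + 3) ω = X (k + 1) ω := by
  have h1 := (hid (k + 1) (Finset.mem_Icc.2 ⟨by omega, by omega⟩)).symm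
  have h2 := h1.ae_snd (p := fun m : ℕ => (m : ℝ) ≤ C₀) (Set.to_countable _).measurableSet hC
  filter_upwards [h2] with ω hω
  have : X (k + 1) ω ≤ ⌊C₀⌋₊ := Nat.le_floor hω
  simp only [paddedTruncation, if_pos (show 3 ≤ k + 3 ∧ k + 3 < n + 3 by omega)]
  exact min_eq_left this

/-- Truncation at `⌊C₀⌋₊` turns the almost sure bound into a sure one without changing the law. The
moment bounds are equalities at genuine indices, and at padded ones they reduce to nonnegativity of
the moments. -/
lemma isOneDependentArray_paddedTruncation {C₀ : ℝ}
    (hX : ∀ k ∈ Finset.Icc 1 n, Measurable (X k))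
    (hid : ∀ k ∈ Finset.Icc 1 n, IdentDistrib (X k) (X 1) μ μ) (hdep : IsMDependent 1 n X μ)
    (hmix : ∀ k ∈ Finset.Ico 1 n, mixedMoment (X k) (X (k + 1)) μ = mixedMoment (X 1) (X 2) μ)
    (hC : ∀ᵐ ω ∂μ, (X 1 ω : ℝ) ≤ C₀) :
    IsOneDependentArray μ (paddedTruncation X n ⌊C₀⌋₊) n ⌊C₀⌋₊ (factMoment1 (X 1) μ)
      (factMoment2 (X 1) μ) (mixedMoment (X 1) (X 2) μ) := by
  have hae : ∀ k < n, ∀ᵐ ω ∂μ, paddedTruncation X n ⌊C₀⌋₊ (k + 3) ω = X (k + 1) ω :=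
    fun k hk => paddedTruncation_ae_eq hid hC hk
  have hidk : ∀ k < n, IdentDistrib (X (k + 1)) (X 1) μ μ := fun k hk =>
    hid (k + 1) (Finset.mem_Icc.2 ⟨by omega, by omega⟩)
  have hmean : ∀ k < n, ∫ ω, (paddedTruncation X n ⌊C₀⌋₊ (k + 3) ω : ℝ) ∂μ =
      factMoment1 (X 1) μ := fun k hk => by
    refine (integral_congr_ae ?_).trans
      ((hidk k hk).comp (measurable_of_countable fun m : ℕ => (m : ℝ))).integral_eq
    filter_upwards [hae k hk] with ω hω
    simp [hω, Function.comp]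
  have hfact : ∀ k < n, ∫ ω, (paddedTruncation X n ⌊C₀⌋₊ (k + 3) ω : ℝ) *
      ((paddedTruncation X n ⌊C₀⌋₊ (k + 3) ω : ℝ) - 1) ∂μ = factMoment2 (X 1) μ := fun k hk => by
    refine (integral_congr_ae ?_).trans ((hidk k hk).comp
      (measurable_of_countable fun m : ℕ => (m : ℝ) * ((m : ℝ) - 1))).integral_eq
    filter_upwards [hae k hk] with ω hω
    simp [hω, Function.comp]
  have hsplit : ∀ j, (∃ k < n, j = k + 3) ∨ ¬(3 ≤ j ∧ j < n + 3) := fun j => by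
    by_cases h : 3 ≤ j ∧ j < n + 3
    · exact Or.inl ⟨j - 3, by omega, by omega⟩
    · exact Or.inr h
  have hzero : ∀ j, ¬(3 ≤ j ∧ j < n + 3) → ∀ ω, paddedTruncation X n ⌊C₀⌋₊ j ω = 0 :=
    fun j hj ω => paddedTruncation_of_not hj ω
  refine ⟨fun j => ?_, fun j ω => ?_, indep_sigmaOf_paddedTruncation hdep,
    fun j hj => hzero j (by omega), fun j hj => hzero j (by omega), hmean, fun j => ?_, fun j => ?_,
    fun j => ?_⟩
  · rcases hsplit j with ⟨k, hk, rfl⟩ | hj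
    · exact measurable_iff_comap_le.2 ((comap_paddedTruncation_le (k + 3)).trans
        (hX (k + 1) (Finset.mem_Icc.2 ⟨by omega, by omega⟩)).comap_le)
    · exact measurable_iff_comap_le.2 ((comap_paddedTruncation_of_not hj).le.trans bot_le)
  · unfold paddedTruncation
    split_ifs
    · exact min_le_right _ _
    · exact Nat.zero_le _
  · rcases hsplit j with ⟨k, hk, rfl⟩ | hj
    · exact (hmean k hk).le
    · simp only [hzero j hj, Nat.cast_zero, integral_zero]
      exact integral_nonneg fun ω => Nat.cast_nonneg _
  · rcases hsplit j with ⟨k, hk, rfl⟩ | hj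
    · exact (hfact k hk).le
    · simp only [hzero j hj, Nat.cast_zero, zero_mul, integral_zero]
      exact integral_nonneg fun ω => IsOneDependentArray.nat_mul_sub_one_nonneg _
  · have hκ : 0 ≤ mixedMoment (X 1) (X 2) μ :=
      integral_nonneg fun ω => mul_nonneg (Nat.cast_nonneg _) (Nat.cast_nonneg _)
    rcases hsplit j with ⟨k, hk, rfl⟩ | hj
    · rcases hsplit (k + 3 + 1) with ⟨k', hk', h'⟩ | hj'
      · obtain rfl : k' = k + 1 := by omega
        rw [← hmix (k + 1) (Finset.mem_Ico.2 ⟨by omega, hk'⟩), mixedMoment]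
        refine le_of_eq (integral_congr_ae ?_)
        filter_upwards [hae k hk, hae (k + 1) hk'] with ω h1 h2
        rw [h', h1, h2]
      · simpa only [hzero _ hj', Nat.cast_zero, mul_zero, integral_zero] using hκ
    · simpa only [hzero j hj, Nat.cast_zero, zero_mul, integral_zero] using hκ

lemma measure_sum_eq_paddedTruncation {C₀ : ℝ}
    (hid : ∀ k ∈ Finset.Icc 1 n, IdentDistrib (X k) (X 1) μ μ)
    (hC : ∀ᵐ ω ∂μ, (X 1 ω : ℝ) ≤ C₀) (x : ℕ) :
    μ.real {ω | x ≤ ∑ k ∈ Finset.Icc 1 n, X k ω} =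
      μ.real {ω | x ≤ ∑ k ∈ Finset.range n, paddedTruncation X n ⌊C₀⌋₊ (k + 3) ω} := by
  have hall : ∀ᵐ ω ∂μ, ∀ k : ℕ, k < n → paddedTruncation X n ⌊C₀⌋₊ (k + 3) ω = X (k + 1) ω :=
    ae_all_iff.2 fun k => by
      by_cases hk : k < n
      · filter_upwards [paddedTruncation_ae_eq hid hC hk] with ω hω _ using hω
      · exact ae_of_all _ fun ω h => absurd h hk
  refine measureReal_congr ?_
  filter_upwards [hall] with ω hω
  have h1 : ∑ k ∈ Finset.Icc 1 n, X k ω =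
      ∑ k ∈ Finset.range n, paddedTruncation X n ⌊C₀⌋₊ (k + 3) ω := by
    rw [← Finset.Ico_succ_right_eq_Icc, Finset.sum_Ico_eq_sum_range]
    refine Finset.sum_congr (by simp) fun k hk => ?_
    rw [hω k (by simpa using hk), add_comm]
  exact congrArg (x ≤ ·) h1

end Transfer

/-! ### The theorem. -/

theorem theorem2 :
    ∃ C₃ > (0 : ℝ), ∃ C₄ > (0 : ℝ),
      ∀ (Ω : Type*) [MeasurableSpace Ω] (μ : Measure Ω) [IsProbabilityMeasure μ]
        (n x : ℕ) (X : ℕ → Ω → ℕ) (C₀ ν₁ ν₂ κ y γ : ℝ),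
        1 ≤ n →
        (∀ k ∈ Finset.Icc 1 n, Measurable (X k)) →
        (∀ k ∈ Finset.Icc 1 n, IdentDistrib (X k) (X 1) μ μ) →
        IsMDependent 1 n X μ →
        (∀ k ∈ Finset.Ico 1 n, mixedMoment (X k) (X (k + 1)) μ = mixedMoment (X 1) (X 2) μ) →
        ν₁ = factMoment1 (X 1) μ →
        ν₂ = factMoment2 (X 1) μ →
        κ = mixedMoment (X 1) (X 2) μ →
        y = relDev n x ν₁ →
        γ = gammaCoeff C₀ ν₁ ν₂ κ →
        0 < ν₁ →
        1 ≤ C₀ →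
        (∀ᵐ ω ∂μ, (X 1 ω : ℝ) ≤ C₀) →
        Real.exp (5 * C₀) * ν₁ ≤ 0.002 →
        |y| ≤ 1 / 10 →
        ν₂ ≤ ν₁ * Real.exp (-(1.5 * C₀)) / 20 →
        κ ≤ ν₁ * Real.exp (-(1.5 * C₀)) / 20 →
        (n : ℝ) * ν₁ < x →
        ∃ θ : ℝ, |θ| ≤ 1 ∧
          μ.real {ω | x ≤ ∑ k ∈ Finset.Icc 1 n, X k ω} / poissonTail (n * lambdaStar ν₁ y) x =
            Real.exp (LambdaStar n ν₁ y) * (1 + C₃ * γ * y ^ 2) ^ n *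
              (1 + C₄ * θ * γ * Real.sqrt (n * ν₁) * (ν₁⁻¹ + n * y ^ 2)) := by
  refine ⟨5, by norm_num, 10000 * Real.exp 8, by positivity, ?_⟩
  intro Ω _ μ _ n x X C₀ ν₁ ν₂ κ y γ hn hX hid hdep hmix hν₁ hν₂ hκ hy hγ hν0 hC₀ hC hν hy' hν₂'
    hκ' hx
  have harr := isOneDependentArray_paddedTruncation hX hid hdep hmix hC
  rw [← hν₁, ← hν₂, ← hκ] at harr
  have hE := Real.exp_pos (1.5 * C₀)
  have hEE : Real.exp (1.5 * C₀) * Real.exp (-(1.5 * C₀)) = 1 := by rw [← Real.exp_add]; simp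
  have hνsmall : ν₁ ≤ 1 / 1000 := by
    have h1 : 6 ≤ Real.exp (5 * C₀) := by linarith [Real.add_one_le_exp (5 * C₀)]
    have h2 : 6 * ν₁ ≤ Real.exp (5 * C₀) * ν₁ := by gcongr
    norm_num at hν
    linarith
  have hγ₁ : Real.exp (1.5 * C₀) * ν₁ ^ 2 ≤ γ := by
    rw [hγ, gammaCoeff]; gcongr; exact (le_max_left _ _).trans (le_max_left _ _)
  have hγ₂ : Real.exp (1.5 * C₀) * ν₂ ≤ γ := by
    rw [hγ, gammaCoeff]; gcongr; exact (le_max_right _ _).trans (le_max_left _ _)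
  have hγ₃ : Real.exp (1.5 * C₀) * κ ≤ γ := by
    rw [hγ, gammaCoeff]; gcongr; exact le_max_right _ _
  -- The factor `e^{-1.5 C₀}` in the moment hypotheses cancels the one in `γ`, which gives `γ ≤ 1`.
  have hmom : ∀ a, a ≤ ν₁ * Real.exp (-(1.5 * C₀)) / 20 → Real.exp (1.5 * C₀) * a ≤ 1 := by
    intro a ha
    calc _ ≤ Real.exp (1.5 * C₀) * (ν₁ * Real.exp (-(1.5 * C₀)) / 20) := by gcongr
      _ = ν₁ / 20 * (Real.exp (1.5 * C₀) * Real.exp (-(1.5 * C₀))) := by ring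
      _ ≤ 1 := by rw [hEE]; linarith
  have hsq : Real.exp (1.5 * C₀) * ν₁ ^ 2 ≤ 1 := by
    have h1 : Real.exp (1.5 * C₀) ≤ Real.exp (5 * C₀) := Real.exp_le_exp.2 (by linarith)
    norm_num at hν
    calc _ ≤ Real.exp (5 * C₀) * ν₁ ^ 2 := by gcongr
      _ = Real.exp (5 * C₀) * ν₁ * ν₁ := by ring
      _ ≤ 1 * 1 := by gcongr <;> linarith
      _ = 1 := one_mul 1
  have hγ1 : γ ≤ 1 := by
    rw [hγ, gammaCoeff, mul_max_of_nonneg _ _ hE.le, mul_max_of_nonneg _ _ hE.le]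
    exact max_le (max_le hsq (hmom _ hν₂')) (hmom _ hκ')
  obtain ⟨θ, hθ, h⟩ := harr.exists_tail_expansion (Nat.floor_le (by linarith)) hC₀ hγ₁ hγ₂ hγ₃ hγ1
    hν0 hνsmall hn hx hy hy'
  refine ⟨θ, hθ, ?_⟩
  rw [← h, measure_sum_eq_paddedTruncation hid hC]
  simp_rw [harr.sum_range_eq]
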